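/- **Theorem (Harmony).** Let $\mathcal N$ be a countably infinite set of names. Processes are $$P,Q ::= 0 \mid P\,|\,Q \mid (\nu a)P \mid \overline a\langle b\rangle.P \mid a(x).P \mid (a)P \mid \overline a\{b\}.P \mid a\{b\}.P \mid\ !a(x).P ,$$ that is: inaction, parallel composition, restriction, output, input, authorization scope, sending and receiving an authorization for $b$ along $a$, and replicated input. The name $a$ is binding in $(\nu a)P$ and $x$ is binding in $a(x).P$ and $!a(x).P$; all other occurrences are free. Processes are identified up to $\alpha$-conversion, $\mathrm{fn}(P)$ is the set of free names and $P\{b/x\}$ is capture-avoiding substitution. *Structural congruence* $\equiv$ is the least congruence with $P|0\equiv P$; $P|Q\equiv Q|P$; $(P|Q)|R\equiv P|(Q|R)$; $(\nu a)0\equiv 0$; $(\nu a)(\nu b)P\equiv(\nu b)(\nu a)P$; $!a(x).P\equiv\ !a(x).P\,|\,(a)a(x).P$; $P|(\nu a)Q\equiv(\nu a)(P|Q)$ if $a\notin\mathrm{fn}(P)$; $(a)(b)P\equiv(b)(a)P$; $(a)0\equiv0$; $(a)(\nu b)P\equiv(\nu b)(a)P$ if $a\ne b$. *Static contexts* with one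 hole are $C ::= \cdot \mid P|C \mid (a)C$, and with two holes $D ::= C_1|C_2 \mid P|D \mid (a)D$, where $(C_1|C_2)[P,Q]=C_1[P]\,|\,C_2[Q]$. Below, $\tilde a,\tilde b,\tilde d,\tilde e$ are finite multisets of names. The partial operation *drift* is given inductively, on one-hole contexts, by $\mathrm{drift}(\cdot;\emptyset;\tilde d)=\cdot$; $\mathrm{drift}((c)C;\tilde a,c;\tilde d)=C'$ if $\mathrm{drift}(C;\tilde a;\tilde d,c)=C'$; $\mathrm{drift}((c)C;\tilde a;\tilde d)=(c)C'$ if $\mathrm{drift}(C;\tilde a;\tilde d)=C'$ and $c\notin\tilde d$; $\mathrm{drift}(R|C;\tilde a;\tilde d)=R|C'$ if $\mathrm{drift}(C;\tilde a;\tilde d)=C'$; and on two-hole contexts by $\mathrm{drift}(C_1|C_2;\tilde a;\tilde b;\tilde d;\tilde e)=C_1'|C_2'$ if $\mathrm{drift}(C_1;\tilde a;\tilde d)=C_1'$ and $\mathrm{drift}(C_2;\tilde b;\tilde e)=C_2'$; $\mathrm{drift}((c)D;\tilde a,c;\tilde b;\tilde d;\tilde e)=D'$ if $\mathrm{drift}(D;\tilde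 a;\tilde b;\tilde d,c;\tilde e)=D'$; $\mathrm{drift}((c)D;\tilde a;\tilde b,c;\tilde d;\tilde e)=D'$ if $\mathrm{drift}(D;\tilde a;\tilde b;\tilde d;\tilde e,c)=D'$; $\mathrm{drift}((c)D;\tilde a;\tilde b;\tilde d;\tilde e)=(c)D'$ if $\mathrm{drift}(D;\tilde a;\tilde b;\tilde d;\tilde e)=D'$ and $c\notin\tilde d,\tilde e$; $\mathrm{drift}(R|D;\tilde a;\tilde b;\tilde d;\tilde e)=R|D'$ if $\mathrm{drift}(D;\tilde a;\tilde b;\tilde d;\tilde e)=D'$. Write $\mathrm{drift}(D;\tilde a;\tilde b)$ for $\mathrm{drift}(D;\tilde a;\tilde b;\emptyset;\emptyset)$. *Reduction* $\to$ is the least relation such that $D[\overline a\langle b\rangle.P,\,a(x).Q]\to D'[(a)P,\,(a)Q\{b/x\}]$ if $\mathrm{drift}(D;a;a)=D'$; $D[\overline a\{b\}.P,\,a\{b\}.Q]\to D'[(a)P,\,(a)(b)Q]$ if $\mathrm{drift}(D;a,b;a)=D'$; $P\to Q$ if $P\equiv P'\to Q'\equiv Q$; and $(\nu a)P\to(\nu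 a)Q$ if $P\to Q$. *Actions* are $\alpha ::= (a)^i\overline a\langle b\rangle \mid (a)^i a(b)\mid (a)^i(b)^k\overline a\{b\}\mid (a)^i a\{b\}\mid (\nu b)(a)^i\overline a\langle b\rangle\mid\tau_\omega$ with $i,k\in\{0,1\}$ (an omitted annotation has exponent $0$) and $\omega$ a finite multiset of names, the lacking authorizations; $\omega$ is written as a product, e.g. $(a)^{2}(b)$, and $\omega(a)$ is $\omega$ with one more copy of $a$. The names $\mathrm n(\alpha)$ are $\{a,b\}$, respectively the elements of $\omega$; the bound names are $\mathrm{bn}((\nu b)(a)^i\overline a\langle b\rangle)=\{b\}$ and $\emptyset$ otherwise. Write $\sigma_c$ for any action other than a $\tau_\omega$ whose subject is $c$ with annotation $(c)^0$, and for any $(a)^i(c)^0\overline a\{c\}$; $(c)\sigma_c$ is the action in which this exponent is raised to $1$. *Transitions* form the least relation such that (omitting the mirror images of the rules for $|$) 1. $\overline a\langle b\rangle.P\xrightarrow{\overline a\langle b\rangle}(a)P$; $\ a(x).P\xrightarrow{a(b)}(a)P\{b/x\}$; $\ \overline a\{b\}.P\xrightarrow{\overline a\{b\}}(a)P$; $\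 a\{b\}.P\xrightarrow{a\{b\}}(a)(b)P$; $\ !a(x).P\xrightarrow{(a)a(b)}(a)P\{b/x\}\,|\,!a(x).P$; 2. if $P\xrightarrow{\alpha}Q$ and $\mathrm{bn}(\alpha)\cap\mathrm{fn}(R)=\emptyset$, then $P|R\xrightarrow{\alpha}Q|R$; 3. if $P\xrightarrow{\alpha}Q$ and $a\notin\mathrm n(\alpha)$, then $(\nu a)P\xrightarrow{\alpha}(\nu a)Q$; 4. if $P\xrightarrow{(a)^i\overline a\langle b\rangle}Q$ and $a\neq b$, then $(\nu b)P\xrightarrow{(\nu b)(a)^i\overline a\langle b\rangle}Q$; 5. if $P\xrightarrow{\tau_{\omega(a)}}Q$, then $(a)P\xrightarrow{\tau_\omega}Q$; 6. if $P\xrightarrow{\sigma_a}Q$, then $(a)P\xrightarrow{(a)\sigma_a}Q$; 7. if $P\xrightarrow{\alpha}Q$, where $\alpha$ is neither a $\tau_{\omega(a)}$ nor a $\sigma_a$, and $a\notin\mathrm{bn}(\alpha)$, then $(a)P\xrightarrow{\alpha}(a)Q$; 8. if $P\xrightarrow{(a)^i\overline a\langle b\rangle}P'$ and $Q\xrightarrow{(a)^ja(b)}Q'$,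 then $P|Q\xrightarrow{\tau_\omega}P'|Q'$ with $\omega=(a)^{2-i-j}$; 9. if $P\xrightarrow{(\nu a)(b)^i\overline b\langle a\rangle}P'$, $Q\xrightarrow{(b)^jb(a)}Q'$ and $a\notin\mathrm{fn}(Q)$, then $P|Q\xrightarrow{\tau_\omega}(\nu a)(P'|Q')$ with $\omega=(b)^{2-i-j}$; 10. if $P\xrightarrow{(a)^i(b)^k\overline a\{b\}}P'$ and $Q\xrightarrow{(a)^ja\{b\}}Q'$, then $P|Q\xrightarrow{\tau_\omega}P'|Q'$ with $\omega=(a)^{2-i-j}(b)^{1-k}$. Let $\tau=\tau_\emptyset$ (no authorizations are lacking). Then for all processes $P,Q$: $$P\to Q\quad\Longleftrightarrow\quad\text{there is a process } Q' \text{ with } P\xrightarrow{\tau}Q' \text{ and } Q'\equiv Q .$$ -/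

import Mathlib

namespace FloatAuth

/-- The countably infinite set of names. -/
abbrev Name := ℕ

/-- Processes, identified up to alpha-conversion by means of de Bruijn indices.  In the body of each
of the three binders `nu`, `inp` and `rep`, the name `0` is the bound one, and `n + 1` stands for the
name that is called `n` outside of the binder.  The usual binders with an explicit
bound name are `Proc.res`, `Proc.input` and `Proc.repInput` below. -/
inductive Proc : Type
  /-- inaction `0` -/
  | nil : Proc
  /-- parallel composition `P | Q` -/
  | par (P Q : Proc) : Proc
  /-- restriction (nameless) -/
  | nu (P : Proc) : Proc
  /-- output `a!⟨b⟩.P` -/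
  | out (a b : Name) (P : Proc) : Proc
  /-- input on `a` (nameless) -/
  | inp (a : Name) (P : Proc) : Proc
  /-- authorization scope `(a)P` -/
  | auth (a : Name) (P : Proc) : Proc
  /-- send authorization for `b` along `a`, and continue as `P` -/
  | sauth (a b : Name) (P : Proc) : Proc
  /-- receive authorization for `b` along `a`, and continue as `P` -/
  | rauth (a b : Name) (P : Proc) : Proc
  /-- replicated input on `a` (nameless) -/
  | rep (a : Name) (P : Proc) : Proc

namespace Proc

/-- The action of a name map below a binder. -/
def lift (f : Name → Name) : Name → Name
  | 0 => 0
  | n + 1 => f n + 1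

/-- Capture-avoiding simultaneous renaming of the free names. -/
def rename : Proc → (Name → Name) → Proc
  | nil, _ => nil
  | par P Q, f => par (P.rename f) (Q.rename f)
  | nu P, f => nu (P.rename (lift f))
  | out a b P, f => out (f a) (f b) (P.rename f)
  | inp a P, f => inp (f a) (P.rename (lift f))
  | auth a P, f => auth (f a) (P.rename f)
  | sauth a b P, f => sauth (f a) (f b) (P.rename f)
  | rauth a b P, f => rauth (f a) (f b) (P.rename f)
  | rep a P, f => rep (f a) (P.rename (lift f))

/-- The set of free names. -/
def fn : Proc → Set Name
  | nil => ∅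
  | par P Q => P.fn ∪ Q.fn
  | nu P => {n | n + 1 ∈ P.fn}
  | out a b P => {a, b} ∪ P.fn
  | inp a P => {a} ∪ {n | n + 1 ∈ P.fn}
  | auth a P => {a} ∪ P.fn
  | sauth a b P => {a, b} ∪ P.fn
  | rauth a b P => {a, b} ∪ P.fn
  | rep a P => {a} ∪ {n | n + 1 ∈ P.fn}

/-- Capture-avoiding substitution `P{b/x}` of the name `b` for the free name `x`. -/
def subst (P : Proc) (b x : Name) : Proc :=
  P.rename (fun n => if n = x then b else n)

/-- Turn the free name `a` of `P` into the bound name of a binder that is put around `P`. -/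
def close (a : Name) (P : Proc) : Proc :=
  P.rename (fun n => if n = a then 0 else n + 1)

/-- Restriction `(νa)P`. -/
def res (a : Name) (P : Proc) : Proc := nu (close a P)

/-- Input `a?(x).P`; the name `x` is binding with scope `P`. -/
def input (a x : Name) (P : Proc) : Proc := inp a (close x P)

/-- Replicated input `!a?(x).P`; the name `x` is binding with scope `P`. -/
def repInput (a x : Name) (P : Proc) : Proc := rep a (close x P)

theorem lift_comp (f g : Name → Name) : lift g ∘ lift f = lift (g ∘ f) := by
  funext n; cases n <;> rfl

theorem rename_rename (P : Proc) (f g : Name → Name) :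
    (P.rename f).rename g = P.rename (g ∘ f) := by
  induction P generalizing f g <;> simp_all [rename, lift_comp]

theorem rename_congr (P : Proc) (f g : Name → Name) (h : ∀ n ∈ P.fn, f n = g n) :
    P.rename f = P.rename g := by
  induction P generalizing f g with
  | nil => rfl
  | par P Q ihP ihQ =>
    simp only [rename]
    rw [ihP f g fun n hn => h n (Or.inl hn), ihQ f g fun n hn => h n (Or.inr hn)]
  | nu P ih =>
    simp only [rename]
    rw [ih (lift f) (lift g)]
    rintro (_ | n) hn
    · rfl
    · exact congrArg (· + 1) (h n hn)
  | out a b P ih | sauth a b P ih | rauth a b P ih =>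
    simp only [rename]
    rw [ih f g fun n hn => h n (Or.inr hn), h a (by simp [fn]), h b (by simp [fn])]
  | auth a P ih =>
    simp only [rename]
    rw [ih f g fun n hn => h n (Or.inr hn), h a (by simp [fn])]
  | inp a P ih | rep a P ih =>
    simp only [rename]
    rw [ih (lift f) (lift g), h a (by simp [fn])]
    rintro (_ | n) hn
    · rfl
    · exact congrArg (· + 1) (h n (Or.inr hn))

/-- Alpha-conversion is an equality of processes: a bound name may be replaced by any name that
is not free in the body (the same holds for `res`, `input` and `repInput`, which are all built
from `close`). -/
theorem close_alpha (P : Proc) (a b : Name) (hb : b ∉ P.fn) :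
    close a P = close b (P.subst b a) := by
  unfold close subst
  rw [rename_rename]
  refine rename_congr P _ _ fun n hn => ?_
  have hnb : n ≠ b := fun h => hb (h ▸ hn)
  by_cases h : n = a <;> simp [h, hnb]

end Proc

open Proc

/-- Structural congruence: the least congruence that satisfies the axioms below.  Since
alpha-equivalent processes are equal, alpha-conversion is contained in `refl`. -/
inductive SC : Proc → Proc → Prop
  | refl (P : Proc) : SC P P
  | symm {P Q : Proc} : SC P Q → SC Q P
  | trans {P Q R : Proc} : SC P Q → SC Q R → SC P R
  | par_congr {P P' Q Q' : Proc} : SC P P' → SC Q Q' → SC (par P Q) (par P' Q')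
  | res_congr (a : Name) {P P' : Proc} : SC P P' → SC (res a P) (res a P')
  | out_congr (a b : Name) {P P' : Proc} : SC P P' → SC (out a b P) (out a b P')
  | input_congr (a x : Name) {P P' : Proc} : SC P P' → SC (input a x P) (input a x P')
  | auth_congr (a : Name) {P P' : Proc} : SC P P' → SC (auth a P) (auth a P')
  | sauth_congr (a b : Name) {P P' : Proc} : SC P P' → SC (sauth a b P) (sauth a b P')
  | rauth_congr (a b : Name) {P P' : Proc} : SC P P' → SC (rauth a b P) (rauth a b P')
  | repInput_congr (a x : Name) {P P' : Proc} : SC P P' → SC (repInput a x P) (repInput a x P')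
  | par_inact (P : Proc) : SC (par P nil) P
  | par_comm (P Q : Proc) : SC (par P Q) (par Q P)
  | par_assoc (P Q R : Proc) : SC (par (par P Q) R) (par P (par Q R))
  | res_inact (a : Name) : SC (res a nil) nil
  | res_swap (a b : Name) (P : Proc) : SC (res a (res b P)) (res b (res a P))
  | rep_unfold (a x : Name) (P : Proc) :
      SC (repInput a x P) (par (repInput a x P) (auth a (input a x P)))
  | res_extr (a : Name) (P Q : Proc) (h : a ∉ P.fn) : SC (par P (res a Q)) (res a (par P Q))
  | auth_swap (a b : Name) (P : Proc) : SC (auth a (auth b P)) (auth b (auth a P))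
  | auth_inact (a : Name) : SC (auth a nil) nil
  | scope_auth (a b : Name) (P : Proc) (h : a ≠ b) : SC (auth a (res b P)) (res b (auth a P))

/-- Static contexts with one hole.  (The symmetric case of parallel composition is covered by
structural congruence.) -/
inductive Ctx : Type
  | hole : Ctx
  | par (P : Proc) (C : Ctx) : Ctx
  | auth (a : Name) (C : Ctx) : Ctx

/-- Fill the hole. -/
def Ctx.fill : Ctx → Proc → Proc
  | .hole, P => P
  | .par R C, P => Proc.par R (C.fill P)
  | .auth a C, P => Proc.auth a (C.fill P)

/-- Static contexts with two holes. -/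
inductive Ctx2 : Type
  | split (C₁ C₂ : Ctx) : Ctx2
  | par (P : Proc) (C : Ctx2) : Ctx2
  | auth (a : Name) (C : Ctx2) : Ctx2

/-- Fill both holes. -/
def Ctx2.fill : Ctx2 → Proc → Proc → Proc
  | .split C₁ C₂, P, Q => Proc.par (C₁.fill P) (C₂.fill Q)
  | .par R C, P, Q => Proc.par R (C.fill P Q)
  | .auth a C, P, Q => Proc.auth a (C.fill P Q)

/-- `Drift C a d C'`: the partial operation `drift` on one-hole contexts is defined at `C`, with the
names `a` of the authorizations still to be removed and the names `d` of those already removed, and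
`C'` is its value.  (Lists of names with repetitions whose order is irrelevant: multisets.) -/
inductive Drift : Ctx → Multiset Name → Multiset Name → Ctx → Prop
  | done (d : Multiset Name) : Drift .hole 0 d .hole
  | rem {C C' : Ctx} {a d : Multiset Name} {c : Name} :
      Drift C a (c ::ₘ d) C' → Drift (.auth c C) (c ::ₘ a) d C'
  | skip {C C' : Ctx} {a d : Multiset Name} {c : Name} :
      Drift C a d C' → c ∉ d → Drift (.auth c C) a d (.auth c C')
  | par {C C' : Ctx} {a d : Multiset Name} {R : Proc} :
      Drift C a d C' → Drift (.par R C) a d (.par R C')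

/-- `Drift2 C a b d e C'`: the partial operation `drift` on two-hole contexts; `a` and `d` refer to
the first hole, `b` and `e` refer to the second hole. -/
inductive Drift2 : Ctx2 → Multiset Name → Multiset Name → Multiset Name → Multiset Name →
    Ctx2 → Prop
  | spl {C₁ C₂ C₁' C₂' : Ctx} {a b d e : Multiset Name} :
      Drift C₁ a d C₁' → Drift C₂ b e C₂' →
      Drift2 (.split C₁ C₂) a b d e (.split C₁' C₂')
  | rem_l {C C' : Ctx2} {a b d e : Multiset Name} {c : Name} :
      Drift2 C a b (c ::ₘ d) e C' → Drift2 (.auth c C) (c ::ₘ a) b d e C'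
  | rem_r {C C' : Ctx2} {a b d e : Multiset Name} {c : Name} :
      Drift2 C a b d (c ::ₘ e) C' → Drift2 (.auth c C) a (c ::ₘ b) d e C'
  | skip {C C' : Ctx2} {a b d e : Multiset Name} {c : Name} :
      Drift2 C a b d e C' → c ∉ d → c ∉ e → Drift2 (.auth c C) a b d e (.auth c C')
  | par {C C' : Ctx2} {a b d e : Multiset Name} {R : Proc} :
      Drift2 C a b d e C' → Drift2 (.par R C) a b d e (.par R C')

/-- The reduction relation. -/
inductive Red : Proc → Proc → Prop
  | comm {C C' : Ctx2} (a b x : Name) (P Q : Proc) :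
      Drift2 C {a} {a} 0 0 C' →
      Red (C.fill (out a b P) (input a x Q)) (C'.fill (auth a P) (auth a (Q.subst b x)))
  | deleg {C C' : Ctx2} (a b : Name) (P Q : Proc) :
      Drift2 C {a, b} {a} 0 0 C' →
      Red (C.fill (sauth a b P) (rauth a b Q)) (C'.fill (auth a P) (auth a (auth b Q)))
  | stru {P P' Q Q' : Proc} : SC P P' → Red P' Q' → SC Q' Q → Red P Q
  | newc (a : Name) {P Q : Proc} : Red P Q → Red (res a P) (res a Q)

/-- Actions.  The exponents `i, k ∈ {0, 1}` say whether the action carries the respective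
authorization. -/
inductive Act : Type
  /-- `(a)^i a!⟨b⟩` -/
  | out (i : Fin 2) (a b : Name) : Act
  /-- `(a)^i a?(b)` -/
  | inp (i : Fin 2) (a b : Name) : Act
  /-- `(a)^i (b)^k` followed by the sending of an authorization for `b` along `a` -/
  | sauth (i k : Fin 2) (a b : Name) : Act
  /-- `(a)^i` followed by the reception of an authorization for `b` along `a` -/
  | rauth (i : Fin 2) (a b : Name) : Act
  /-- bound output `(νb)(a)^i a!⟨b⟩` -/
  | bout (i : Fin 2) (a b : Name) : Act
  /-- internal step `τ_ω`, where `ω` is the multiset of the names of the lacking authorizations -/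
  | tau (ω : Multiset Name) : Act

namespace Act

/-- All names of an action. -/
def names : Act → Set Name
  | out _ a b => {a, b}
  | inp _ a b => {a, b}
  | sauth _ _ a b => {a, b}
  | rauth _ a b => {a, b}
  | bout _ a b => {a, b}
  | tau ω => {n | n ∈ ω}

/-- The bound names of an action. -/
def bn : Act → Set Name
  | bout _ _ b => {b}
  | _ => ∅

/-- `Carry c α β`: the action `α` lacks an authorization on `c` (it is of the form `σ_c`), and `β` is
`(c)σ_c`, the same action that now carries that authorization. -/
inductive Carry : Name → Act → Act → Prop
  | out (a b : Name) : Carry a (out 0 a b) (out 1 a b)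
  | inp (a b : Name) : Carry a (inp 0 a b) (inp 1 a b)
  | rauth (a b : Name) : Carry a (rauth 0 a b) (rauth 1 a b)
  | bout (a b : Name) : Carry a (bout 0 a b) (bout 1 a b)
  | sauth_subject (k : Fin 2) (a b : Name) : Carry a (sauth 0 k a b) (sauth 1 k a b)
  | sauth_object (i : Fin 2) (a b : Name) : Carry b (sauth i 0 a b) (sauth i 1 a b)

end Act

/-- The labelled transition relation. -/
inductive Step : Proc → Act → Proc → Prop
  | out (a b : Name) (P : Proc) : Step (out a b P) (.out 0 a b) (auth a P)
  | inp (a x b : Name) (P : Proc) : Step (input a x P) (.inp 0 a b) (auth a (P.subst b x))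
  | out_a (a b : Name) (P : Proc) : Step (sauth a b P) (.sauth 0 0 a b) (auth a P)
  | in_a (a b : Name) (P : Proc) : Step (rauth a b P) (.rauth 0 a b) (auth a (auth b P))
  | in_rep (a x b : Name) (P : Proc) :
      Step (repInput a x P) (.inp 1 a b) (par (auth a (P.subst b x)) (repInput a x P))
  | par_l {P Q : Proc} {α : Act} (R : Proc) :
      Step P α Q → α.bn ∩ R.fn = ∅ → Step (par P R) α (par Q R)
  | par_r {P Q : Proc} {α : Act} (R : Proc) :
      Step P α Q → α.bn ∩ R.fn = ∅ → Step (par R P) α (par R Q)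
  | res {P Q : Proc} {α : Act} (a : Name) :
      Step P α Q → a ∉ α.names → Step (res a P) α (res a Q)
  | opn {P Q : Proc} {i : Fin 2} {a b : Name} :
      Step P (.out i a b) Q → a ≠ b → Step (Proc.res b P) (.bout i a b) Q
  | scope_int {P Q : Proc} {ω : Multiset Name} {a : Name} :
      Step P (.tau (a ::ₘ ω)) Q → Step (auth a P) (.tau ω) Q
  | scope_ext {P Q : Proc} {α β : Act} {a : Name} :
      Step P α Q → Act.Carry a α β → Step (auth a P) β Q
  /-- The last premise is the convention that bound names differ from free names. -/
  | scope {P Q : Proc} {α : Act} (a : Name) :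
      Step P α Q → (∀ ω, α ≠ .tau (a ::ₘ ω)) → (∀ β, ¬ Act.Carry a α β) → a ∉ α.bn →
      Step (auth a P) α (auth a Q)
  | comm_l {P P' Q Q' : Proc} {i j : Fin 2} {a b : Name} :
      Step P (.out i a b) P' → Step Q (.inp j a b) Q' →
      Step (par P Q) (.tau (Multiset.replicate (2 - (i : ℕ) - (j : ℕ)) a)) (par P' Q')
  | comm_r {P P' Q Q' : Proc} {i j : Fin 2} {a b : Name} :
      Step P (.out i a b) P' → Step Q (.inp j a b) Q' →
      Step (par Q P) (.tau (Multiset.replicate (2 - (i : ℕ) - (j : ℕ)) a)) (par Q' P')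
  | close_l {P P' Q Q' : Proc} {i j : Fin 2} {a b : Name} :
      Step P (.bout i b a) P' → Step Q (.inp j b a) Q' → a ∉ Q.fn →
      Step (par P Q) (.tau (Multiset.replicate (2 - (i : ℕ) - (j : ℕ)) b))
        (Proc.res a (par P' Q'))
  | close_r {P P' Q Q' : Proc} {i j : Fin 2} {a b : Name} :
      Step P (.bout i b a) P' → Step Q (.inp j b a) Q' → a ∉ Q.fn →
      Step (par Q P) (.tau (Multiset.replicate (2 - (i : ℕ) - (j : ℕ)) b))
        (Proc.res a (par Q' P'))
  | auth_l {P P' Q Q' : Proc} {i j k : Fin 2} {a b : Name} :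
      Step P (.sauth i k a b) P' → Step Q (.rauth j a b) Q' →
      Step (par P Q)
        (.tau (Multiset.replicate (2 - (i : ℕ) - (j : ℕ)) a + Multiset.replicate (1 - (k : ℕ)) b))
        (par P' Q')
  | auth_r {P P' Q Q' : Proc} {i j k : Fin 2} {a b : Name} :
      Step P (.sauth i k a b) P' → Step Q (.rauth j a b) Q' →
      Step (par Q P)
        (.tau (Multiset.replicate (2 - (i : ℕ) - (j : ℕ)) a + Multiset.replicate (1 - (k : ℕ)) b))
        (par Q' P')

/-- The transition relation `τ`, in which no authorizations are lacking. -/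
def TauStep (P Q : Proc) : Prop := Step P (.tau 0) Q

end FloatAuth

namespace FloatAuth

open Proc

/-! ### Renamings of names -/

/-! Both relations are compared with a third one, the late transition relation `LStep`. Its binders
are nameless, an input leaves its residual below a binder instead of choosing the received name, and
the annotations of an action are replaced by the multiset `L` of authorizations that the step still
lacks. A scope on `c` is consumed if `c` is lacking and kept otherwise (`use`, `keep`), and a
communication adds the two multisets. The three scope rules of the labelled semantics thus become
two, and all communication rules become one.

Labelled and late transitions agree: `Step.lstep` and `LStep.step_rename` translate one into the
other, and for internal steps the residuals are equal (`Step.lstep_tau`, `LStep.step_tau`).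
Structural congruence has an equivalent nameless form `NSC` without side conditions (`SC.nsc`,
`NSC.sc`).

From reductions to steps: drift is the same bookkeeping read from the outside inwards. The names
already removed by outer scopes are those that the enclosed process still lacks, and the condition
under which drift skips a scope is the condition of `keep`. Hence a filled context makes the
expected late step (`Drift2.lstep`). Closure under structural congruence is the main work: `NSC.sim`
shows, axiom by axiom, that congruent processes match each other's late steps up to congruence.

From steps to reductions: up to congruence, a visible step that is not a bound output comes from a
prefix in a static context below restrictions (`LStep.normStep`). Replication is unfolded once. A
bound output is a free output below an outermost restriction (`LStep.bout_inv`), so scope extrusion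
becomes an ordinary communication below that restriction. Combining two such steps gives a
normal-form reduction (`LStep.normRed`), which `NormRed.red` turns into a reduction with named
binders.

Passing from nameless to named binders always uses the same device: the statement is strengthened to
all suitable renamings `f`, and below a binder the induction hypothesis is applied to `ncons a f`
with `a` a suitably fresh name. -/

/-- Extend a renaming by the image of the bound name. -/
def ncons (x : Name) (f : Name → Name) : Name → Name
  | 0 => x
  | n + 1 => f n

/-- Exchange the names of the two innermost binders. -/
def swp : Name → Name
  | 0 => 1
  | 1 => 0
  | n + 2 => n + 2

theorem swp_injective : Function.Injective swp := by
  rintro (_ | _ | n) (_ | _ | m) h <;> simp_all [swp]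

theorem ncons_comp_succ (x : Name) (f : Name → Name) : ncons x f ∘ Nat.succ = f := rfl

namespace Proc

theorem lift_comp_succ (f : Name → Name) : lift f ∘ Nat.succ = Nat.succ ∘ f := rfl

theorem lift_id : lift id = id := by funext n; cases n <;> rfl

theorem rename_id (P : Proc) : P.rename id = P := by
  induction P <;> simp_all [rename, lift_id]

theorem lift_injective {f : Name → Name} (hf : f.Injective) : (lift f).Injective := by
  rintro (_ | n) (_ | m) h <;> simp_all [lift]
  exact hf h

theorem fn_rename (P : Proc) (f : Name → Name) : (P.rename f).fn = f '' P.fn := by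
  have key : ∀ (f : Name → Name) (S : Set Name),
      {n | n + 1 ∈ lift f '' S} = f '' {n | n + 1 ∈ S} := by
    intro f S
    ext n
    constructor
    · rintro ⟨_ | m, hm, h⟩
      · simp [lift] at h
      · exact ⟨m, hm, by simpa [lift] using h⟩
    · rintro ⟨m, hm, rfl⟩
      exact ⟨m + 1, hm, rfl⟩
  induction P generalizing f <;> simp_all [rename, fn, Set.image_union, Set.image_insert_eq]

theorem finite_fn (P : Proc) : P.fn.Finite := by
  have key : ∀ S : Set Name, S.Finite → {n | n + 1 ∈ S}.Finite := fun S hS =>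
    hS.preimage (fun a _ b _ h => Nat.succ_injective h)
  induction P <;> simp_all [fn]

/-- Instantiate the outermost bound name of the body of a binder. -/
def inst (P : Proc) (x : Name) : Proc := P.rename (ncons x id)

/-- Weakening by one bound name. -/
def up (P : Proc) : Proc := P.rename Nat.succ

theorem rename_ext {P : Proc} {f g : Name → Name} (h : ∀ n, f n = g n) : P.rename f = P.rename g :=
  congrArg _ (funext h)

theorem subst_eq (P : Proc) (b x : Name) : P.subst b x = (close x P).inst b := by
  unfold subst close inst
  rw [rename_rename]
  refine rename_ext fun n => ?_
  by_cases h : n = x <;> simp [h, ncons]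

theorem inst_close (P : Proc) (a : Name) : (close a P).inst a = P := by
  unfold close inst
  rw [rename_rename]
  conv_rhs => rw [← P.rename_id]
  refine rename_ext fun n => ?_
  by_cases h : n = a <;> simp [h, ncons]

theorem close_rename_ncons (P : Proc) (f : Name → Name) (a : Name)
    (h : ∀ n, n + 1 ∈ P.fn → f n ≠ a) :
    close a (P.rename (ncons a f)) = P.rename (lift f) := by
  unfold close
  rw [rename_rename]
  refine rename_congr _ _ _ fun n hn => ?_
  cases n with
  | zero => simp [ncons, lift]
  | succ n => simp [ncons, lift, h n hn]

theorem close_inst (P : Proc) (a : Name) (h : a + 1 ∉ P.fn) : close a (P.inst a) = P := by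
  unfold inst
  rw [close_rename_ncons, lift_id, rename_id]
  rintro n hn rfl
  exact h hn

/-- The left side unfolds to the free names of `res a P`; this recovers the usual description of
them. -/
theorem fn_nu_close (P : Proc) (a : Name) : {n | n + 1 ∈ (close a P).fn} = P.fn \ {a} := by
  ext n
  simp only [close, fn_rename, Set.mem_ofPred_eq, Set.mem_image, Set.mem_sdiff,
    Set.mem_singleton_iff]
  constructor
  · rintro ⟨m, hm, h⟩
    split_ifs at h
    have e : m = n := by simpa using h
    subst e
    exact ⟨hm, by assumption⟩
  · rintro ⟨hn, ha⟩
    exact ⟨n, hn, by simp [ha]⟩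

/-- Every nameless restriction is a restriction of a fresh name. -/
theorem nu_rename_eq_res (P : Proc) (f : Name → Name) (a : Name)
    (h : ∀ n, n + 1 ∈ P.fn → f n ≠ a) :
    nu (P.rename (lift f)) = res a (P.rename (ncons a f)) := by
  rw [res, close_rename_ncons P f a h]

end Proc

/-- The injection of names that underlies `close a`. -/
def closeMap (a : Name) (n : Name) : Name := if n = a then 0 else n + 1

theorem closeMap_injective (a : Name) : (closeMap a).Injective := by
  intro m n h
  unfold closeMap at h
  split_ifs at h <;> simp_all

/-! ### Structural congruence without names for the binders -/

/-- Structural congruence, with nameless binders. -/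
inductive NSC : Proc → Proc → Prop
  | refl (P : Proc) : NSC P P
  | symm {P Q : Proc} : NSC P Q → NSC Q P
  | trans {P Q R : Proc} : NSC P Q → NSC Q R → NSC P R
  | par_congr {P P' Q Q' : Proc} : NSC P P' → NSC Q Q' → NSC (par P Q) (par P' Q')
  | nu_congr {P P' : Proc} : NSC P P' → NSC (nu P) (nu P')
  | out_congr (a b : Name) {P P' : Proc} : NSC P P' → NSC (out a b P) (out a b P')
  | inp_congr (a : Name) {P P' : Proc} : NSC P P' → NSC (inp a P) (inp a P')
  | auth_congr (a : Name) {P P' : Proc} : NSC P P' → NSC (auth a P) (auth a P')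
  | sauth_congr (a b : Name) {P P' : Proc} : NSC P P' → NSC (sauth a b P) (sauth a b P')
  | rauth_congr (a b : Name) {P P' : Proc} : NSC P P' → NSC (rauth a b P) (rauth a b P')
  | rep_congr (a : Name) {P P' : Proc} : NSC P P' → NSC (rep a P) (rep a P')
  | par_inact (P : Proc) : NSC (par P nil) P
  | par_comm (P Q : Proc) : NSC (par P Q) (par Q P)
  | par_assoc (P Q R : Proc) : NSC (par (par P Q) R) (par P (par Q R))
  | nu_inact : NSC (nu nil) nil
  | nu_swap (P : Proc) : NSC (nu (nu P)) (nu (nu (P.rename swp)))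
  | rep_unfold (a : Name) (P : Proc) : NSC (rep a P) (par (rep a P) (auth a (inp a P)))
  | nu_extr (P Q : Proc) : NSC (par P (nu Q)) (nu (par P.up Q))
  | auth_swap (a b : Name) (P : Proc) : NSC (auth a (auth b P)) (auth b (auth a P))
  | auth_inact (a : Name) : NSC (auth a nil) nil
  | scope_auth (a : Name) (P : Proc) : NSC (auth a (nu P)) (nu (auth (a + 1) P))

/-- The nameless axioms carry no side conditions: freshness is expressed by weakening, and that
commutes with every renaming. Hence no injectivity is needed. -/
theorem NSC.rename {P Q : Proc} (h : NSC P Q) (f : Name → Name) :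
    NSC (P.rename f) (Q.rename f) := by
  induction h generalizing f with
  | refl P => exact .refl _
  | symm _ ih => exact (ih f).symm
  | trans _ _ ih₁ ih₂ => exact (ih₁ f).trans (ih₂ f)
  | par_congr _ _ ih₁ ih₂ => exact .par_congr (ih₁ f) (ih₂ f)
  | nu_congr _ ih => exact .nu_congr (ih _)
  | out_congr a b _ ih => exact .out_congr _ _ (ih f)
  | inp_congr a _ ih => exact .inp_congr _ (ih _)
  | auth_congr a _ ih => exact .auth_congr _ (ih f)
  | sauth_congr a b _ ih => exact .sauth_congr _ _ (ih f)
  | rauth_congr a b _ ih => exact .rauth_congr _ _ (ih f)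
  | rep_congr a _ ih => exact .rep_congr _ (ih _)
  | par_inact P => exact .par_inact _
  | par_comm P Q => exact .par_comm _ _
  | par_assoc P Q R => exact .par_assoc _ _ _
  | nu_inact => exact .nu_inact
  | nu_swap P =>
    have := NSC.nu_swap (P.rename (lift (lift f)))
    simp only [Proc.rename]
    rw [rename_rename] at this ⊢
    convert this using 4
    funext n; rcases n with _ | _ | n <;> rfl
  | rep_unfold a P => exact .rep_unfold _ _
  | nu_extr P Q =>
    have := NSC.nu_extr (P.rename f) (Q.rename (lift f))
    simpa only [Proc.rename, up, rename_rename, lift_comp_succ] using this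
  | auth_swap a b P => exact .auth_swap _ _ _
  | auth_inact a => exact .auth_inact _
  | scope_auth a P => exact .scope_auth _ _

theorem SC.nsc {P Q : Proc} (h : SC P Q) : NSC P Q := by
  induction h with
  | refl P => exact .refl _
  | symm _ ih => exact ih.symm
  | trans _ _ ih₁ ih₂ => exact ih₁.trans ih₂
  | par_congr _ _ ih₁ ih₂ => exact .par_congr ih₁ ih₂
  | res_congr a _ ih => exact .nu_congr (ih.rename _)
  | out_congr a b _ ih => exact .out_congr _ _ ih
  | input_congr a x _ ih => exact .inp_congr _ (ih.rename _)
  | auth_congr a _ ih => exact .auth_congr _ ih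
  | sauth_congr a b _ ih => exact .sauth_congr _ _ ih
  | rauth_congr a b _ ih => exact .rauth_congr _ _ ih
  | repInput_congr a x _ ih => exact .rep_congr _ (ih.rename _)
  | par_inact P => exact .par_inact _
  | par_comm P Q => exact .par_comm _ _
  | par_assoc P Q R => exact .par_assoc _ _ _
  | res_inact a => exact .nu_inact
  | res_swap a b P =>
    -- If the names coincide, the two sides are the same process; otherwise exchanging the binders
    -- amounts to `swp` on the doubly closed body.
    by_cases hab : a = b
    · subst hab; exact .refl _
    · have := NSC.nu_swap ((P.rename (closeMap b)).rename (lift (closeMap a)))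
      simp only [rename_rename] at this
      simp only [res, close, Proc.rename, rename_rename]
      refine this.trans ?_
      convert NSC.refl _ using 3
      refine rename_ext fun n => ?_
      simp only [Function.comp, closeMap]
      by_cases h1 : n = a
      · have : n ≠ b := fun h => hab (h1 ▸ h)
        simp [lift, swp, h1, hab, closeMap]
      · by_cases h2 : n = b
        · subst h2
          simp [lift, swp, h1]
        · simp [lift, swp, h1, h2, closeMap]
  | rep_unfold a x P => exact .rep_unfold _ _
  | res_extr a P Q h =>
    have : close a P = P.up := rename_congr _ _ _ fun n hn => by
      simp [show n ≠ a from fun e => h (e ▸ hn)]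
    have e : res a (par P Q) = nu (par (close a P) (close a Q)) := rfl
    rw [e, this]
    exact .nu_extr _ _
  | auth_swap a b P => exact .auth_swap _ _ _
  | auth_inact a => exact .auth_inact _
  | scope_auth a b P h =>
    have e : res b (auth a P) = nu (auth (closeMap b a) (close b P)) := rfl
    rw [e, closeMap, if_neg h]
    exact .scope_auth _ _

theorem exists_fresh {S : Set Name} (hS : S.Finite) (f : Name → Name) : ∃ a, ∀ n ∈ S, f n ≠ a := by
  obtain ⟨a, ha⟩ := (hS.image f).exists_notMem
  exact ⟨a, fun n hn h => ha ⟨n, hn, h⟩⟩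

theorem finite_pred {S : Set Name} (hS : S.Finite) : {n : Name | n + 1 ∈ S}.Finite :=
  hS.preimage (fun _ _ _ _ h => Nat.succ_injective h)

/-- The renaming makes the induction pass binders: a nameless body is opened with a name `a` that is
fresh on both sides, by using the hypothesis at `ncons a f`, and `res a` or `input _ a` closes it
again. Only `f = id` is wanted for `NSC.sc`. -/
theorem NSC.sc_rename {P Q : Proc} (h : NSC P Q) (f : Name → Name) :
    SC (P.rename f) (Q.rename f) := by
  have fresh : ∀ (S T : Proc) (f : Name → Name), ∃ a, (∀ n, n + 1 ∈ S.fn → f n ≠ a) ∧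
      ∀ n, n + 1 ∈ T.fn → f n ≠ a := by
    intro S T f
    obtain ⟨a, ha⟩ := exists_fresh
      ((finite_pred S.finite_fn).union (finite_pred T.finite_fn)) f
    exact ⟨a, fun n hn => ha n (Or.inl hn), fun n hn => ha n (Or.inr hn)⟩
  induction h generalizing f with
  | refl P => exact .refl _
  | symm _ ih => exact (ih f).symm
  | trans _ _ ih₁ ih₂ => exact (ih₁ f).trans (ih₂ f)
  | par_congr _ _ ih₁ ih₂ => exact .par_congr (ih₁ f) (ih₂ f)
  | @nu_congr P P' _ ih =>
    obtain ⟨a, h₁, h₂⟩ := fresh P P' f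
    simp only [Proc.rename]
    rw [nu_rename_eq_res P f a h₁, nu_rename_eq_res P' f a h₂]
    exact .res_congr a (ih _)
  | out_congr a b _ ih => exact .out_congr _ _ (ih f)
  | @inp_congr c P P' _ ih =>
    obtain ⟨a, h₁, h₂⟩ := fresh P P' f
    simp only [Proc.rename]
    rw [← close_rename_ncons P f a h₁, ← close_rename_ncons P' f a h₂]
    exact .input_congr _ a (ih _)
  | auth_congr a _ ih => exact .auth_congr _ (ih f)
  | sauth_congr a b _ ih => exact .sauth_congr _ _ (ih f)
  | rauth_congr a b _ ih => exact .rauth_congr _ _ (ih f)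
  | @rep_congr c P P' _ ih =>
    obtain ⟨a, h₁, h₂⟩ := fresh P P' f
    simp only [Proc.rename]
    rw [← close_rename_ncons P f a h₁, ← close_rename_ncons P' f a h₂]
    exact .repInput_congr _ a (ih _)
  | par_inact P => exact .par_inact _
  | par_comm P Q => exact .par_comm _ _
  | par_assoc P Q R => exact .par_assoc _ _ _
  | nu_inact => exact .res_inact 0
  | nu_swap P =>
    obtain ⟨a, ha⟩ := exists_fresh (finite_pred (finite_pred P.finite_fn)) f
    -- The body lies below two binders, so its outer names are the `n + 2`; the two opening names
    -- must also differ from each other.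
    obtain ⟨b, hb, hab⟩ : ∃ b, (∀ n, n + 2 ∈ P.fn → f n ≠ b) ∧ b ≠ a := by
      obtain ⟨b, hb⟩ := (((finite_pred (finite_pred P.finite_fn)).image f).union
        (Set.finite_singleton a)).exists_notMem
      exact ⟨b, fun n hn e => hb (Or.inl ⟨n, hn, e⟩), fun e => hb (Or.inr e)⟩
    have key := SC.res_swap a b (P.rename (ncons b (ncons a f)))
    simp only [Proc.rename, rename_rename]
    convert key using 1
    · simp only [res, close, Proc.rename, rename_rename]
      congr 2
      refine rename_congr _ _ _ fun n hn => ?_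
      rcases n with _ | _ | n
      · simp [lift, ncons]
      · simp [lift, ncons, hab.symm]
      · simp [lift, ncons, hb n hn, ha n hn]
    · simp only [res, close, Proc.rename, rename_rename]
      congr 2
      refine rename_congr _ _ _ fun n hn => ?_
      rcases n with _ | _ | n
      · simp [lift, ncons, hab, swp]
      · simp [lift, ncons, swp]
      · simp [lift, ncons, hb n hn, ha n hn, swp]
  | rep_unfold c P =>
    obtain ⟨a, h₁, -⟩ := fresh P P f
    simp only [Proc.rename]
    rw [← close_rename_ncons P f a h₁]
    exact .rep_unfold _ a _
  | nu_extr P Q =>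
    obtain ⟨a, h₁, h₂⟩ := fresh P.up Q f
    have e : nu (par (P.up.rename (lift f)) (Q.rename (lift f)))
        = res a (par (P.rename f) (Q.rename (ncons a f))) := by
      have h := nu_rename_eq_res (par P.up Q) f a (by
        rintro n (hn | hn)
        · exact h₁ n hn
        · exact h₂ n hn)
      simpa only [Proc.rename, up, rename_rename, ncons_comp_succ] using h
    simp only [Proc.rename]
    rw [e, nu_rename_eq_res Q f a h₂]
    refine .res_extr a _ _ ?_
    rw [fn_rename]
    rintro ⟨n, hn, h⟩
    refine h₁ n ?_ h
    rw [up, fn_rename]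
    exact ⟨n, hn, rfl⟩
  | auth_swap a b P => exact .auth_swap _ _ _
  | auth_inact a => exact .auth_inact _
  | scope_auth c P =>
    -- The auxiliary component makes `c + 1` free, so that freshness also yields `f c ≠ a`, the side
    -- condition of `scope_auth`.
    obtain ⟨a, h₁, -⟩ := fresh (par (auth (c + 1) nil) P) nil f
    have e := nu_rename_eq_res (auth (c + 1) P) f a (by
      intro n hn
      exact h₁ n (by simpa [fn] using hn))
    simp only [Proc.rename] at e ⊢
    rw [e, nu_rename_eq_res P f a (fun n hn => h₁ n (Or.inr hn))]
    exact .scope_auth _ _ _ (h₁ c (by simp [fn]))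

theorem NSC.sc {P Q : Proc} (h : NSC P Q) : SC P Q := by
  simpa only [rename_id] using h.sc_rename id

/-! ### A late, nameless transition relation -/

/-- Labels without annotations.  The residuals of an input (which is late) and of a bound output live
below one more binder. -/
inductive Label : Type
  | out (a b : Name) : Label
  | inp (a : Name) : Label
  | sauth (a b : Name) : Label
  | rauth (a b : Name) : Label
  | bout (a : Name) : Label
  | tau : Label

namespace Label

/-- Apply a renaming to a label. -/
def map (f : Name → Name) : Label → Label
  | out a b => out (f a) (f b)
  | inp a => inp (f a)
  | sauth a b => sauth (f a) (f b)
  | rauth a b => rauth (f a) (f b)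
  | bout a => bout (f a)
  | tau => tau

/-- The weakening of names that takes place when they pass to a residual. -/
def sh : Label → Name → Name
  | inp _ | bout _ => Nat.succ
  | _ => id

/-- A renaming, as it acts on a residual. -/
def lift : Label → (Name → Name) → Name → Name
  | inp _, f | bout _, f => Proc.lift f
  | _, f => f

/-- The exchange of names that takes place when a restriction is put around a residual. -/
def sw : Label → Name → Name
  | inp _ | bout _ => swp
  | _ => id

/-- The instantiation of a residual. -/
def ins (x : Name) : Label → Name → Name
  | inp _ | bout _ => ncons x id
  | _ => id

/-- The names of a label. -/
def names : Label → Set Name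
  | out a b => {a, b}
  | inp a => {a}
  | sauth a b => {a, b}
  | rauth a b => {a, b}
  | bout a => {a}
  | tau => ∅

@[simp] theorem map_map (κ : Label) (f g : Name → Name) : (κ.map f).map g = κ.map (g ∘ f) := by
  cases κ <;> rfl

@[simp] theorem sh_map (κ : Label) (f : Name → Name) : (κ.map f).sh = κ.sh := by cases κ <;> rfl

@[simp] theorem sw_map (κ : Label) (f : Name → Name) : (κ.map f).sw = κ.sw := by cases κ <;> rfl

@[simp] theorem lift_map (κ : Label) (f : Name → Name) : (κ.map f).lift = κ.lift := by
  cases κ <;> rfl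

@[simp] theorem ins_map (κ : Label) (f : Name → Name) (x : Name) :
    (κ.map f).ins x = κ.ins x := by cases κ <;> rfl

theorem lift_comp_sh (κ : Label) (f : Name → Name) : κ.lift f ∘ κ.sh = κ.sh ∘ f := by
  cases κ <;> rfl

theorem lift_sh (κ : Label) (f : Name → Name) (n : Name) : κ.lift f (κ.sh n) = κ.sh (f n) := by
  cases κ <;> rfl

theorem lift_lift_comp_sw (κ : Label) (f : Name → Name) :
    Proc.lift (κ.lift f) ∘ κ.sw = κ.sw ∘ κ.lift (Proc.lift f) := by
  cases κ <;> funext n <;> rcases n with _ | _ | n <;> rfl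

theorem sh_injective (κ : Label) : κ.sh.Injective := by
  cases κ <;> first | exact Nat.succ_injective | exact fun _ _ h => h

theorem sw_injective (κ : Label) : κ.sw.Injective := by
  cases κ <;> first | exact swp_injective | exact fun _ _ h => h

theorem map_succ_lift (κ : Label) (f : Name → Name) :
    (κ.map Nat.succ).map (Proc.lift f) = (κ.map f).map Nat.succ := by
  cases κ <;> rfl

end Label

/-- `Sync κ₁ κ₂ F`: the labels `κ₁` and `κ₂` match, and `F` combines the two residuals. -/
inductive Sync : Label → Label → (Proc → Proc → Proc) → Prop
  | out_inp (a b : Name) : Sync (.out a b) (.inp a) (fun P Q => par P (Q.inst b))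
  | inp_out (a b : Name) : Sync (.inp a) (.out a b) (fun P Q => par (P.inst b) Q)
  | sauth_rauth (a b : Name) : Sync (.sauth a b) (.rauth a b) par
  | rauth_sauth (a b : Name) : Sync (.rauth a b) (.sauth a b) par
  | bout_inp (a : Name) : Sync (.bout a) (.inp a) (fun P Q => nu (par P Q))
  | inp_bout (a : Name) : Sync (.inp a) (.bout a) (fun P Q => nu (par P Q))

/-- The late transition relation; the multiset contains the authorizations that the step lacks. -/
inductive LStep : Proc → Label → Multiset Name → Proc → Prop
  | out (a b : Name) (P : Proc) : LStep (out a b P) (.out a b) {a} (auth a P)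
  | inp (a : Name) (P : Proc) : LStep (inp a P) (.inp a) {a} (auth (a + 1) P)
  | sauth (a b : Name) (P : Proc) : LStep (sauth a b P) (.sauth a b) {a, b} (auth a P)
  | rauth (a b : Name) (P : Proc) : LStep (rauth a b P) (.rauth a b) {a} (auth a (auth b P))
  | rep (a : Name) (P : Proc) : LStep (rep a P) (.inp a) 0 (par (auth (a + 1) P) (rep a P).up)
  | par_l {P P' : Proc} {κ : Label} {L : Multiset Name} (R : Proc) :
      LStep P κ L P' → LStep (par P R) κ L (par P' (R.rename κ.sh))
  | par_r {P P' : Proc} {κ : Label} {L : Multiset Name} (R : Proc) :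
      LStep P κ L P' → LStep (par R P) κ L (par (R.rename κ.sh) P')
  | nu {P P' : Proc} {κ : Label} {L : Multiset Name} :
      LStep P (κ.map Nat.succ) (L.map Nat.succ) P' → LStep (nu P) κ L (nu (P'.rename κ.sw))
  | opn {P P' : Proc} {a : Name} {L : Multiset Name} :
      LStep P (.out (a + 1) 0) (L.map Nat.succ) P' → LStep (nu P) (.bout a) L P'
  | use {P P' : Proc} {κ : Label} {L : Multiset Name} {c : Name} :
      LStep P κ (c ::ₘ L) P' → LStep (auth c P) κ L P'
  | keep {P P' : Proc} {κ : Label} {L : Multiset Name} {c : Name} :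
      LStep P κ L P' → c ∉ L → LStep (auth c P) κ L (auth (κ.sh c) P')
  | sync {P P' Q Q' : Proc} {κ₁ κ₂ : Label} {L₁ L₂ : Multiset Name} {F : Proc → Proc → Proc} :
      LStep P κ₁ L₁ P' → LStep Q κ₂ L₂ Q' → Sync κ₁ κ₂ F →
      LStep (par P Q) .tau (L₁ + L₂) (F P' Q')

theorem Sync.map {κ₁ κ₂ : Label} {F : Proc → Proc → Proc} (h : Sync κ₁ κ₂ F) (f : Name → Name) :
    ∃ F', Sync (κ₁.map f) (κ₂.map f) F' ∧
      ∀ P Q, F' (P.rename (κ₁.lift f)) (Q.rename (κ₂.lift f)) = (F P Q).rename f := by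
  have key : ∀ (P : Proc) (b : Name),
      (P.rename (Proc.lift f)).inst (f b) = (P.inst b).rename f := by
    intro P b
    simp only [inst, rename_rename]
    exact rename_ext fun n => by cases n <;> rfl
  cases h
  · exact ⟨_, .out_inp _ _, fun P Q => congrArg _ (key _ _)⟩
  · exact ⟨_, .inp_out _ _, fun P Q => congrArg (par · _) (key _ _)⟩
  · exact ⟨_, .sauth_rauth _ _, fun P Q => rfl⟩
  · exact ⟨_, .rauth_sauth _ _, fun P Q => rfl⟩
  · exact ⟨_, .bout_inp _, fun P Q => rfl⟩
  · exact ⟨_, .inp_bout _, fun P Q => rfl⟩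

theorem Sync.of_map {κ₁ κ₂ : Label} {F : Proc → Proc → Proc} {f : Name → Name}
    (h : Sync (κ₁.map f) (κ₂.map f) F) (hf : f.Injective) :
    ∃ F', Sync κ₁ κ₂ F' ∧
      ∀ P Q, F (P.rename (κ₁.lift f)) (Q.rename (κ₂.lift f)) = (F' P Q).rename f := by
  -- The labels determine the combining operation, so the commutation law comes from `Sync.map`;
  -- only the match of the original labels has to be found.
  suffices ∃ F', Sync κ₁ κ₂ F' by
    obtain ⟨F', h'⟩ := this
    obtain ⟨F'', h₁, h₂⟩ := h'.map f
    have : F'' = F := by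
      clear h₂
      cases h' <;> simp only [Label.map] at h h₁ <;> cases h <;> cases h₁ <;> rfl
    exact ⟨F', h', this ▸ h₂⟩
  cases κ₁ <;> cases κ₂ <;> simp only [Label.map] at h <;> try (exfalso; cases h)
  case out.inp a b c =>
    generalize e : f c = y at h
    cases h
    obtain rfl := hf e
    exact ⟨_, .out_inp _ _⟩
  case inp.out c a b =>
    generalize e : f c = y at h
    cases h
    obtain rfl := hf e
    exact ⟨_, .inp_out _ _⟩
  case sauth.rauth a b c d =>
    generalize e : f c = y, e' : f d = z at h
    cases h
    obtain rfl := hf e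
    obtain rfl := hf e'
    exact ⟨_, .sauth_rauth _ _⟩
  case rauth.sauth a b c d =>
    generalize e : f c = y, e' : f d = z at h
    cases h
    obtain rfl := hf e
    obtain rfl := hf e'
    exact ⟨_, .rauth_sauth _ _⟩
  case bout.inp a c =>
    generalize e : f c = y at h
    cases h
    obtain rfl := hf e
    exact ⟨_, .bout_inp _⟩
  case inp.bout c a =>
    generalize e : f c = y at h
    cases h
    obtain rfl := hf e
    exact ⟨_, .inp_bout _⟩

/-- Injectivity preserves the negative premise `c ∉ L` of `keep`: identifying two names could force
a scope to be consumed that was kept before. -/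
theorem LStep.rename {P P' : Proc} {κ : Label} {L : Multiset Name} (h : LStep P κ L P')
    {f : Name → Name} (hf : f.Injective) :
    LStep (P.rename f) (κ.map f) (L.map f) (P'.rename (κ.lift f)) := by
  induction h generalizing f with
  | out a b P => simpa [Proc.rename, Label.map, Label.lift] using LStep.out (f a) (f b) (P.rename f)
  | inp a P => simpa [Proc.rename, Label.map, Label.lift, lift] using LStep.inp (f a) (P.rename (lift f))
  | sauth a b P => simpa [Proc.rename, Label.map, Label.lift] using LStep.sauth (f a) (f b) (P.rename f)
  | rauth a b P => simpa [Proc.rename, Label.map, Label.lift] using LStep.rauth (f a) (f b) (P.rename f)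
  | rep a P =>
    have := LStep.rep (f a) (P.rename (lift f))
    have e : (Proc.rep (f a) (P.rename (lift f))).up = (Proc.rep a P).up.rename (lift f) := by
      rw [up, up, rename_rename, lift_comp_succ, ← rename_rename]; rfl
    rw [e] at this
    simpa [Proc.rename, Label.map, Label.lift, lift] using this
  | @par_l P P' κ L R _ ih =>
    have := (ih hf).par_l (R.rename f)
    simpa only [Proc.rename, rename_rename, Label.sh_map, Label.lift_comp_sh] using this
  | @par_r P P' κ L R _ ih =>
    have := (ih hf).par_r (R.rename f)
    simpa only [Proc.rename, rename_rename, Label.sh_map, Label.lift_comp_sh] using this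
  | @nu P P' κ L _ ih =>
    have h := ih (Proc.lift_injective hf)
    rw [Label.map_succ_lift, Multiset.map_map, lift_comp_succ, ← Multiset.map_map] at h
    have := h.nu
    simpa only [Proc.rename, rename_rename, Label.sw_map, Label.lift_map,
      Label.lift_lift_comp_sw] using this
  | @opn P P' a L _ ih =>
    have h := ih (Proc.lift_injective hf)
    rw [Multiset.map_map, lift_comp_succ, ← Multiset.map_map] at h
    exact .opn h
  | @use P P' κ L c _ ih =>
    have h := ih hf
    rw [Multiset.map_cons] at h
    exact .use h
  | @keep P P' κ L c _ hc ih =>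
    have := (ih hf).keep (c := f c) (by rwa [Multiset.mem_map_of_injective hf])
    simpa only [Proc.rename, Label.lift_sh, Label.sh_map] using this
  | @sync P P' Q Q' κ₁ κ₂ L₁ L₂ F _ _ hs ih₁ ih₂ =>
    obtain ⟨F', h₁, h₂⟩ := hs.map f
    have := (ih₁ hf).sync (ih₂ hf) h₁
    rw [h₂, ← Multiset.map_add] at this
    exact this

theorem exists_eq_map_succ {L : Multiset Name} (h : 0 ∉ L) :
    ∃ L' : Multiset Name, L = L'.map Nat.succ := by
  refine ⟨L.map Nat.pred, ?_⟩
  rw [Multiset.map_map]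
  conv_lhs => rw [← L.map_id]
  refine Multiset.map_congr rfl fun n hn => ?_
  cases n with
  | zero => exact absurd hn h
  | succ n => rfl

/-- The bound name `0` is not a successor, and `lift f` sends only successors to successors. Thus
everything in `L` comes from outside the binder. -/
theorem map_succ_eq_map_lift {L L' : Multiset Name} {f : Name → Name}
    (h : L'.map Nat.succ = L.map (lift f)) : ∃ M : Multiset Name, L = M.map Nat.succ ∧ L' = M.map f := by
  obtain ⟨M, rfl⟩ := exists_eq_map_succ (L := L) (fun h0 => by
    have := Multiset.mem_map_of_mem (lift f) h0
    rw [← h] at this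
    simp [lift] at this)
  refine ⟨M, rfl, ?_⟩
  rw [Multiset.map_map, lift_comp_succ, ← Multiset.map_map] at h
  exact Multiset.map_injective Nat.succ_injective h

theorem lift_eq_succ {f : Name → Name} {m n : Name} (h : n + 1 = lift f m) :
    ∃ k, m = k + 1 ∧ n = f k := by
  cases m with
  | zero => simp [lift] at h
  | succ k => exact ⟨k, rfl, by simpa [lift] using h⟩

theorem Label.map_succ_eq_map_lift {κ κ' : Label} {f : Name → Name}
    (h : κ'.map Nat.succ = κ.map (Proc.lift f)) : ∃ μ : Label, κ = μ.map Nat.succ ∧ κ' = μ.map f := by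
  cases κ <;> cases κ' <;> simp only [Label.map, Label.out.injEq, Label.inp.injEq,
    Label.sauth.injEq, Label.rauth.injEq, Label.bout.injEq, reduceCtorEq] at h
  case tau.tau => exact ⟨.tau, rfl, rfl⟩
  case inp.inp =>
    obtain ⟨k, rfl, rfl⟩ := lift_eq_succ h
    exact ⟨.inp k, rfl, rfl⟩
  case bout.bout =>
    obtain ⟨k, rfl, rfl⟩ := lift_eq_succ h
    exact ⟨.bout k, rfl, rfl⟩
  all_goals
    obtain ⟨h₁, h₂⟩ := h
    obtain ⟨k, rfl, rfl⟩ := lift_eq_succ h₁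
    obtain ⟨l, rfl, rfl⟩ := lift_eq_succ h₂
  · exact ⟨.out k l, rfl, rfl⟩
  · exact ⟨.sauth k l, rfl, rfl⟩
  · exact ⟨.rauth k l, rfl, rfl⟩

/-- Converse of `LStep.rename`. It is needed for scope extrusion read backwards, where a step of
`P.up` has to be recognized as a weakened step of `P`. -/
theorem LStep.of_rename {P X : Proc} {κ' : Label} {L' : Multiset Name} {f : Name → Name}
    (h : LStep (P.rename f) κ' L' X) (hf : f.Injective) :
    ∃ κ L P', κ' = κ.map f ∧ L' = L.map f ∧ X = P'.rename (κ.lift f) ∧ LStep P κ L P' := by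
  induction P generalizing f κ' L' X with
  | nil => cases h
  | out a b P => cases h; exact ⟨_, _, _, rfl, by simp, rfl, .out a b P⟩
  | inp a P => cases h; exact ⟨_, _, _, rfl, by simp, rfl, .inp a P⟩
  | sauth a b P => cases h; exact ⟨_, _, _, rfl, by simp, rfl, .sauth a b P⟩
  | rauth a b P => cases h; exact ⟨_, _, _, rfl, by simp, rfl, .rauth a b P⟩
  | rep a P =>
    cases h
    refine ⟨_, _, _, rfl, by simp, ?_, .rep a P⟩
    simp only [Label.lift, Proc.rename, up, rename_rename, Proc.lift_comp, lift_comp_succ]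
    rfl
  | par P Q ihP ihQ =>
    cases h with
    | par_l _ h =>
      obtain ⟨κ, L, P', rfl, rfl, rfl, h'⟩ := ihP h hf
      refine ⟨_, _, _, rfl, rfl, ?_, h'.par_l Q⟩
      simp only [Proc.rename, rename_rename, Label.sh_map, Label.lift_comp_sh]
    | par_r _ h =>
      obtain ⟨κ, L, P', rfl, rfl, rfl, h'⟩ := ihQ h hf
      refine ⟨_, _, _, rfl, rfl, ?_, h'.par_r P⟩
      simp only [Proc.rename, rename_rename, Label.sh_map, Label.lift_comp_sh]
    | sync h₁ h₂ hs =>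
      obtain ⟨κ₁, L₁, P', rfl, rfl, rfl, h₁'⟩ := ihP h₁ hf
      obtain ⟨κ₂, L₂, Q', rfl, rfl, rfl, h₂'⟩ := ihQ h₂ hf
      obtain ⟨F', hs', e⟩ := hs.of_map hf
      exact ⟨_, _, _, rfl, (Multiset.map_add _ _ _).symm, e _ _, h₁'.sync h₂' hs'⟩
  | nu P ih =>
    cases h with
    | nu h =>
      obtain ⟨κ, L, P', e₁, e₂, rfl, h'⟩ := ih h (Proc.lift_injective hf)
      obtain ⟨κ, rfl, rfl⟩ := Label.map_succ_eq_map_lift e₁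
      obtain ⟨L, rfl, rfl⟩ := map_succ_eq_map_lift e₂
      refine ⟨_, _, _, rfl, rfl, ?_, h'.nu⟩
      simp only [Proc.rename, rename_rename, Label.sw_map, Label.lift_map,
        Label.lift_lift_comp_sw]
    | opn h =>
      obtain ⟨κ, L, P', e₁, e₂, rfl, h'⟩ := ih h (Proc.lift_injective hf)
      cases κ <;> simp only [Label.map, Label.out.injEq, reduceCtorEq] at e₁
      obtain ⟨e₁, e₃⟩ := e₁
      obtain ⟨k, rfl, rfl⟩ := lift_eq_succ e₁
      obtain rfl := Proc.lift_injective hf (a₁ := 0) e₃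
      obtain ⟨L, rfl, rfl⟩ := map_succ_eq_map_lift e₂
      exact ⟨_, _, P', rfl, rfl, rfl, h'.opn⟩
  | auth c P ih =>
    cases h with
    | use h =>
      obtain ⟨κ, L, P', rfl, e, rfl, h'⟩ := ih h hf
      obtain ⟨d, hd, e₁, e₂⟩ := (Multiset.map_eq_cons _ _ _ _).2 e.symm
      obtain rfl := hf e₁
      refine ⟨κ, L.erase d, P', rfl, e₂.symm, rfl, .use ?_⟩
      rwa [Multiset.cons_erase hd]
    | keep h hc =>
      obtain ⟨κ, L, P', rfl, rfl, rfl, h'⟩ := ih h hf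
      refine ⟨_, _, _, rfl, rfl, ?_, h'.keep (c := c) fun hm => hc (Multiset.mem_map_of_mem f hm)⟩
      simp only [Proc.rename, Label.lift_sh, Label.sh_map]

/-- A step creates no free names, except for the slot `0` in the residual of an input or bound
output, which `κ.sh` skips. All later freshness arguments about residuals rest on this. -/
theorem LStep.fn {P P' : Proc} {κ : Label} {L : Multiset Name} (h : LStep P κ L P') :
    κ.names ⊆ P.fn ∧ (∀ c ∈ L, c ∈ P.fn) ∧ ∀ n, κ.sh n ∈ P'.fn → n ∈ P.fn := by
  have sh_mem : ∀ (κ : Label) (R : Proc) n, κ.sh n ∈ (R.rename κ.sh).fn → n ∈ R.fn := by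
    intro κ R n h
    rw [fn_rename] at h
    obtain ⟨m, hm, e⟩ := h
    exact κ.sh_injective e ▸ hm
  induction h with
  | out a b P => simp [Proc.fn, Label.names, Label.sh]; tauto
  | inp a P => simp [Proc.fn, Label.names, Label.sh]
  | sauth a b P => simp [Proc.fn, Label.names, Label.sh]; tauto
  | rauth a b P => simp [Proc.fn, Label.names, Label.sh]; tauto
  | rep a P =>
    refine ⟨by simp [Proc.fn, Label.names], by simp, ?_⟩
    intro n hn
    rcases hn with hn | hn
    · simpa [Proc.fn, Label.sh] using hn
    · exact sh_mem (.inp a) _ _ hn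
  | @par_l P P' κ L R _ ih =>
    refine ⟨fun n hn => Or.inl (ih.1 hn), fun c hc => Or.inl (ih.2.1 c hc), ?_⟩
    rintro n (hn | hn)
    · exact Or.inl (ih.2.2 n hn)
    · exact Or.inr (sh_mem _ _ _ hn)
  | @par_r P P' κ L R _ ih =>
    refine ⟨fun n hn => Or.inr (ih.1 hn), fun c hc => Or.inr (ih.2.1 c hc), ?_⟩
    rintro n (hn | hn)
    · exact Or.inl (sh_mem _ _ _ hn)
    · exact Or.inr (ih.2.2 n hn)
  | @nu P P' κ L _ ih =>
    obtain ⟨h₁, h₂, h₃⟩ := ih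
    refine ⟨?_, fun c hc => h₂ _ (Multiset.mem_map_of_mem _ hc), fun n hn => h₃ (n + 1) ?_⟩
    · cases κ <;> simp_all [Label.names, Label.map, Set.insert_subset_iff, Proc.fn]
    · simp only [Proc.fn, fn_rename, Set.mem_ofPred_eq] at hn
      obtain ⟨m, hm, e⟩ := hn
      have : m = (κ.map Nat.succ).sh (n + 1) := by
        refine κ.sw_injective (e.trans ?_)
        cases κ <;> rfl
      exact this ▸ hm
  | @opn P P' a L _ ih =>
    obtain ⟨h₁, h₂, h₃⟩ := ih
    refine ⟨?_, fun c hc => h₂ _ (Multiset.mem_map_of_mem _ hc), fun n hn => h₃ (n + 1) hn⟩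
    simp_all [Label.names, Set.insert_subset_iff, Proc.fn]
  | use _ ih =>
    exact ⟨fun n hn => Or.inr (ih.1 hn),
      fun c hc => Or.inr (ih.2.1 c (Multiset.mem_cons_of_mem hc)), fun n hn => Or.inr (ih.2.2 n hn)⟩
  | @keep P P' κ L c _ hc ih =>
    refine ⟨fun n hn => Or.inr (ih.1 hn), fun c hc => Or.inr (ih.2.1 c hc), ?_⟩
    rintro n (hn | hn)
    · exact Or.inl (κ.sh_injective hn)
    · exact Or.inr (ih.2.2 n hn)
  | @sync P P' Q Q' κ₁ κ₂ L₁ L₂ F _ _ hs ih₁ ih₂ =>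
    obtain ⟨a₁, a₂, a₃⟩ := ih₁
    obtain ⟨b₁, b₂, b₃⟩ := ih₂
    have inst_mem : ∀ (R : Proc) b n, n ∈ (R.inst b).fn → n = b ∨ n + 1 ∈ R.fn := by
      intro R b n h
      rw [inst, fn_rename] at h
      obtain ⟨_ | m, hm, rfl⟩ := h
      · exact Or.inl rfl
      · exact Or.inr hm
    refine ⟨by simp [Label.names], ?_, fun n hn => ?_⟩
    · intro c hc
      rcases Multiset.mem_add.1 hc with hc | hc
      · exact Or.inl (a₂ c hc)
      · exact Or.inr (b₂ c hc)
    · cases hs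
      · rcases hn with hn | hn
        · exact Or.inl (a₃ n hn)
        · rcases inst_mem _ _ _ hn with rfl | hn
          · exact Or.inl (a₁ (by simp [Label.names, Label.sh]))
          · exact Or.inr (b₃ n hn)
      · rcases hn with hn | hn
        · rcases inst_mem _ _ _ hn with rfl | hn
          · exact Or.inr (b₁ (by simp [Label.names, Label.sh]))
          · exact Or.inl (a₃ n hn)
        · exact Or.inr (b₃ n hn)
      all_goals exact hn.imp (a₃ n) (b₃ n)

/-! ### Structural congruence is a simulation for the late transition relation -/

theorem swp_comp_swp : swp ∘ swp = id := by funext n; rcases n with _ | _ | n <;> rfl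

theorem swp_comp_succ : swp ∘ Nat.succ = lift Nat.succ := by funext n; cases n <;> rfl

theorem swp_comp_lift_succ : swp ∘ lift Nat.succ = Nat.succ := by funext n; cases n <;> rfl

theorem Label.sw_comp_sh (κ : Label) : κ.sw ∘ κ.sh = Proc.lift κ.sh := by
  cases κ <;> first | exact swp_comp_succ | exact Proc.lift_id.symm

theorem Label.sw_comp_lift_succ (κ : Label) : κ.sw ∘ κ.lift Nat.succ = Nat.succ := by
  cases κ <;> first | exact swp_comp_lift_succ | rfl

theorem Label.map_succ_injective : (Label.map Nat.succ).Injective := by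
  intro κ μ h
  cases κ <;> cases μ <;> simp_all [Label.map]

theorem Proc.inst_up (P : Proc) (x : Name) : P.up.inst x = P := by
  rw [up, inst, rename_rename, ncons_comp_succ, rename_id]

theorem Proc.rename_lift_succ_inst (P : Proc) : (P.rename (Proc.lift Nat.succ)).inst 0 = P := by
  rw [inst, rename_rename]
  conv_rhs => rw [← P.rename_id]
  exact rename_ext fun n => by cases n <;> rfl

theorem NSC.of_eq {P Q : Proc} (h : P = Q) : NSC P Q := h ▸ .refl P

theorem NSC.extr_nu (P Q : Proc) : NSC (par (nu P) Q) (nu (par P Q.up)) :=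
  (NSC.par_comm _ _).trans ((NSC.nu_extr _ _).trans (.nu_congr (.par_comm _ _)))

/-! ### Communication operations up to structural congruence -/

namespace Sync

variable {κ₁ κ₂ : Label} {F : Proc → Proc → Proc}

theorem unique (h : Sync κ₁ κ₂ F) {F' : Proc → Proc → Proc} (h' : Sync κ₁ κ₂ F') : F = F' := by
  cases h <;> cases h' <;> rfl

theorem congr (h : Sync κ₁ κ₂ F) {P P' Q Q' : Proc} (hP : NSC P P') (hQ : NSC Q Q') :
    NSC (F P Q) (F P' Q') := by
  cases h
  · exact .par_congr hP (hQ.rename _)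
  · exact .par_congr (hP.rename _) hQ
  · exact .par_congr hP hQ
  · exact .par_congr hP hQ
  · exact .nu_congr (.par_congr hP hQ)
  · exact .nu_congr (.par_congr hP hQ)

theorem comm (h : Sync κ₁ κ₂ F) : ∃ F', Sync κ₂ κ₁ F' ∧ ∀ P Q, NSC (F P Q) (F' Q P) := by
  cases h
  · exact ⟨_, .inp_out _ _, fun P Q => .par_comm _ _⟩
  · exact ⟨_, .out_inp _ _, fun P Q => .par_comm _ _⟩
  · exact ⟨_, .rauth_sauth _ _, fun P Q => .par_comm _ _⟩
  · exact ⟨_, .sauth_rauth _ _, fun P Q => .par_comm _ _⟩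
  · exact ⟨_, .inp_bout _, fun P Q => .nu_congr (.par_comm _ _)⟩
  · exact ⟨_, .bout_inp _, fun P Q => .nu_congr (.par_comm _ _)⟩

/-- A bystander of the second partner leaves the communication. Its weakening is cancelled by the
instantiation of an input, or else undone by pulling it out of the restriction created by an
extrusion. -/
theorem par_right (h : Sync κ₁ κ₂ F) (P Q R : Proc) :
    NSC (F P (par Q (R.rename κ₂.sh))) (par (F P Q) R) := by
  cases h
  · refine NSC.trans (.of_eq ?_) (NSC.par_assoc P (Q.inst _) R).symm
    exact congrArg (fun X => par P (par _ X)) (inst_up R _)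
  · simp only [Label.sh, rename_id]
    exact (NSC.par_assoc _ _ _).symm
  · simp only [Label.sh, rename_id]
    exact (NSC.par_assoc _ _ _).symm
  · simp only [Label.sh, rename_id]
    exact (NSC.par_assoc _ _ _).symm
  · exact (NSC.nu_congr (NSC.par_assoc _ _ _).symm).trans (NSC.extr_nu _ _).symm
  · exact (NSC.nu_congr (NSC.par_assoc _ _ _).symm).trans (NSC.extr_nu _ _).symm

theorem par_mid (h : Sync κ₁ κ₂ F) (P Q R : Proc) :
    NSC (F (par P (R.rename κ₁.sh)) Q) (F P (par (R.rename κ₂.sh) Q)) := by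
  cases h
  · simp only [Label.sh, rename_id]
    refine (NSC.par_assoc _ _ _).trans (.of_eq ?_)
    exact congrArg (fun X => par P (par X _)) (inst_up R _).symm
  · simp only [Label.sh, rename_id]
    refine NSC.trans (.of_eq ?_) (NSC.par_assoc _ _ _)
    exact congrArg (fun X => par (par _ X) _) (inst_up R _)
  · simp only [Label.sh, rename_id]
    exact NSC.par_assoc _ _ _
  · simp only [Label.sh, rename_id]
    exact NSC.par_assoc _ _ _
  · exact .nu_congr (NSC.par_assoc _ _ _)
  · exact .nu_congr (NSC.par_assoc _ _ _)

theorem par_left (h : Sync κ₁ κ₂ F) (P Q R : Proc) :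
    NSC (F (par (R.rename κ₁.sh) P) Q) (par R (F P Q)) := by
  obtain ⟨F', h', e⟩ := h.comm
  refine (h.congr (.par_comm _ _) (.refl _)).trans ((e _ _).trans ((h'.par_right _ _ _).trans ?_))
  exact (NSC.par_comm _ _).trans (.par_congr (.refl _) (e _ _).symm)

/-- A restriction around the second partner can be moved outside the communication. If the
communication itself creates a restriction for an extruded name, the two restrictions must also be
exchanged; this is `two`. -/
theorem nu_right (h : Sync κ₁ κ₂ F) : ∃ F', Sync (κ₁.map Nat.succ) (κ₂.map Nat.succ) F' ∧
    ∀ P Q, NSC (F P (nu (Q.rename κ₂.sw))) (nu (F' (P.rename (κ₁.lift Nat.succ)) Q)) := by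
  have inst_lift : ∀ (P : Proc) b, (P.rename (Proc.lift Nat.succ)).inst (b + 1) = (P.inst b).up := by
    intro P b
    simp only [inst, up, rename_rename]
    exact rename_ext fun n => by cases n <;> rfl
  have inst_nu : ∀ (Q : Proc) b, (nu (Q.rename swp)).inst b = nu (Q.inst (b + 1)) := by
    intro Q b
    simp only [inst, Proc.rename, rename_rename]
    exact congrArg nu (rename_ext fun n => by rcases n with _ | _ | n <;> rfl)
  have two : ∀ P Q : Proc, NSC (nu (par P (nu (Q.rename swp))))
      (nu (nu (par (P.rename (Proc.lift Nat.succ)) Q))) := by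
    intro P Q
    refine (NSC.nu_congr (.nu_extr _ _)).trans ((NSC.nu_swap _).trans (.of_eq ?_))
    simp only [Proc.rename, up, rename_rename, swp_comp_succ, swp_comp_swp, rename_id]
  cases h with
  | out_inp a b =>
    refine ⟨_, .out_inp _ _, fun P Q => ?_⟩
    simp only [Label.sw, inst_nu]
    exact .nu_extr _ _
  | inp_out a b =>
    refine ⟨_, .inp_out _ _, fun P Q => ?_⟩
    simp only [Label.sw, Label.lift, Nat.succ_eq_add_one, inst_lift, rename_id]
    exact .nu_extr _ _
  | sauth_rauth a b =>
    refine ⟨_, .sauth_rauth _ _, fun P Q => ?_⟩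
    simp only [Label.sw, rename_id]
    exact .nu_extr _ _
  | rauth_sauth a b =>
    refine ⟨_, .rauth_sauth _ _, fun P Q => ?_⟩
    simp only [Label.sw, rename_id]
    exact .nu_extr _ _
  | bout_inp a => exact ⟨_, .bout_inp _, fun P Q => two _ _⟩
  | inp_bout a => exact ⟨_, .inp_bout _, fun P Q => two _ _⟩

/-- When one partner does not know the restricted name `0`, the other can mention it only as the
object of an output. That case is the one where the restriction is opened. -/
theorem of_map_succ_left (h : Sync (κ₁.map Nat.succ) κ₂ F) :
    (∃ μ : Label, κ₂ = μ.map Nat.succ) ∨ ∃ a, κ₁ = .inp a ∧ κ₂ = .out (a + 1) 0 := by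
  cases κ₁ <;> cases h
  · exact Or.inl ⟨.inp _, rfl⟩
  · rename_i a b
    rcases b with _ | b
    · exact Or.inr ⟨_, rfl, rfl⟩
    · exact Or.inl ⟨.out a b, rfl⟩
  · exact Or.inl ⟨.bout _, rfl⟩
  · exact Or.inl ⟨.rauth _ _, rfl⟩
  · exact Or.inl ⟨.sauth _ _, rfl⟩
  · exact Or.inl ⟨.inp _, rfl⟩

end Sync

/-- Every late step of `P` is matched by `Q`, up to structural congruence. -/
def Sim (P Q : Proc) : Prop :=
  ∀ ⦃κ L P'⦄, LStep P κ L P' → ∃ Q', LStep Q κ L Q' ∧ NSC P' Q'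

/-! ### Simulation for each congruence rule and axiom -/

namespace Sim

theorem par_congr {P P' Q Q' : Proc} (hP : Sim P P') (hQ : Sim Q Q') (eP : NSC P P')
    (eQ : NSC Q Q') : Sim (par P Q) (par P' Q') := by
  intro κ L X h
  cases h with
  | par_l _ h =>
    obtain ⟨Y, h', e⟩ := hP h
    exact ⟨_, h'.par_l _, .par_congr e (eQ.rename _)⟩
  | par_r _ h =>
    obtain ⟨Y, h', e⟩ := hQ h
    exact ⟨_, h'.par_r _, .par_congr (eP.rename _) e⟩
  | sync h₁ h₂ hs =>
    obtain ⟨Y, h₁', e₁⟩ := hP h₁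
    obtain ⟨Z, h₂', e₂⟩ := hQ h₂
    exact ⟨_, h₁'.sync h₂' hs, hs.congr e₁ e₂⟩

theorem nu_congr {P Q : Proc} (h : Sim P Q) : Sim (nu P) (nu Q) := by
  intro κ L X hX
  cases hX with
  | nu hX =>
    obtain ⟨Y, h', e⟩ := h hX
    exact ⟨_, h'.nu, .nu_congr (e.rename _)⟩
  | opn hX =>
    obtain ⟨Y, h', e⟩ := h hX
    exact ⟨_, h'.opn, e⟩

theorem auth_congr (a : Name) {P Q : Proc} (h : Sim P Q) : Sim (auth a P) (auth a Q) := by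
  intro κ L X hX
  cases hX with
  | use hX =>
    obtain ⟨Y, h', e⟩ := h hX
    exact ⟨_, h'.use, e⟩
  | keep hX hc =>
    obtain ⟨Y, h', e⟩ := h hX
    exact ⟨_, h'.keep hc, .auth_congr _ e⟩

theorem par_comm (P Q : Proc) : Sim (par P Q) (par Q P) := by
  intro κ L X h
  cases h with
  | par_l _ h => exact ⟨_, h.par_r _, .par_comm _ _⟩
  | par_r _ h => exact ⟨_, h.par_l _, .par_comm _ _⟩
  | sync h₁ h₂ hs =>
    obtain ⟨F', hs', e⟩ := hs.comm
    rw [add_comm]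
    exact ⟨_, h₂.sync h₁ hs', e _ _⟩

theorem par_assoc (P Q R : Proc) : Sim (par (par P Q) R) (par P (par Q R)) := by
  intro κ L X h
  cases h with
  | par_l _ h =>
    cases h with
    | par_l _ h => exact ⟨_, h.par_l _, .par_assoc _ _ _⟩
    | par_r _ h => exact ⟨_, (h.par_l _).par_r _, .par_assoc _ _ _⟩
    | sync h₁ h₂ hs =>
      refine ⟨_, h₁.sync (h₂.par_l R) hs, ?_⟩
      simpa only [Label.sh, rename_id] using (hs.par_right _ _ _).symm
  | par_r _ h => exact ⟨_, (h.par_r _).par_r _, .par_assoc _ _ _⟩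
  | sync h₁ h₂ hs =>
    cases h₁ with
    | par_l _ h => exact ⟨_, h.sync (h₂.par_r _) hs, hs.par_mid _ _ _⟩
    | par_r _ h =>
      refine ⟨_, (h.sync h₂ hs).par_r _, ?_⟩
      simpa only [Label.sh, rename_id] using hs.par_left _ _ _
    | sync => cases hs

theorem par_assoc_symm (P Q R : Proc) : Sim (par P (par Q R)) (par (par P Q) R) := by
  intro κ L X h
  cases h with
  | par_r _ h =>
    cases h with
    | par_l _ h => exact ⟨_, (h.par_r _).par_l _, (NSC.par_assoc _ _ _).symm⟩
    | par_r _ h => exact ⟨_, h.par_r _, (NSC.par_assoc _ _ _).symm⟩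
    | sync h₁ h₂ hs =>
      refine ⟨_, (h₁.par_r P).sync h₂ hs, ?_⟩
      simpa only [Label.sh, rename_id] using (hs.par_left _ _ _).symm
  | par_l _ h => exact ⟨_, (h.par_l _).par_l _, (NSC.par_assoc _ _ _).symm⟩
  | sync h₁ h₂ hs =>
    cases h₂ with
    | par_l _ h =>
      refine ⟨_, (h₁.sync h hs).par_l _, ?_⟩
      simpa only [Label.sh, rename_id] using hs.par_right _ _ _
    | par_r _ h => exact ⟨_, (h₁.par_l _).sync h hs, (hs.par_mid _ _ _).symm⟩
    | sync => cases hs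

/-- Exchanging the restrictions exchanges their roles: a name extruded by the inner one is extruded
by the outer one afterwards, and conversely. -/
theorem nu_swap (P : Proc) : Sim (nu (nu P)) (nu (nu (P.rename swp))) := by
  have comp : (swp ∘ Nat.succ) ∘ Nat.succ = Nat.succ ∘ Nat.succ := rfl
  intro κ L X h
  cases h with
  | nu h =>
    generalize eκ : κ.map Nat.succ = κ' at h
    cases h with
    | nu h =>
      subst eκ
      have h' := h.rename swp_injective
      rw [Label.map_map, Label.map_map, Multiset.map_map, Multiset.map_map, comp,
        ← Label.map_map, ← Multiset.map_map] at h'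
      refine ⟨_, h'.nu.nu, ?_⟩
      refine (NSC.nu_swap _).trans (.of_eq ?_)
      simp only [Proc.rename, rename_rename, Label.lift_map, Label.sw_map]
      refine congrArg (fun X => nu (nu X)) (rename_ext fun n => ?_)
      cases κ <;> rcases n with _ | _ | _ | n <;> rfl
    | opn h =>
      cases κ <;> simp only [Label.map, Label.bout.injEq, reduceCtorEq] at eκ
      subst eκ
      have h' := h.rename swp_injective
      rw [Multiset.map_map, Multiset.map_map, comp, ← Multiset.map_map] at h'
      exact ⟨_, (LStep.nu (κ := .out _ 0) h').opn, .of_eq (congrArg nu (rename_id _).symm)⟩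
  | opn h =>
    cases h with
    | nu h =>
      have h' := h.rename swp_injective
      rw [Multiset.map_map, Multiset.map_map, comp, ← Multiset.map_map] at h'
      refine ⟨_, (LStep.opn h').nu, .of_eq (congrArg nu ?_)⟩
      simp only [Label.sw, Label.lift, Label.map, rename_rename, swp_comp_swp]

theorem nu_extr (P Q : Proc) : Sim (par P (nu Q)) (nu (par P.up Q)) := by
  intro κ L X h
  cases h with
  | par_l _ h =>
    refine ⟨_, ((h.rename Nat.succ_injective).par_l Q).nu, (NSC.nu_extr _ _).trans (.of_eq ?_)⟩
    simp only [Proc.rename, up, rename_rename, Label.sh_map, Label.sw_comp_sh,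
      Label.sw_comp_lift_succ]
  | par_r _ h =>
    cases h with
    | nu h =>
      refine ⟨_, (h.par_r P.up).nu, (NSC.nu_extr _ _).trans (.of_eq ?_)⟩
      simp only [Proc.rename, up, rename_rename, Label.sh_map, ← Function.comp_assoc,
        Label.sw_comp_sh, lift_comp_succ]
    | opn h =>
      refine ⟨_, (h.par_r P.up).opn, .of_eq ?_⟩
      simp only [Label.sh, rename_id]
      rfl
  | sync h₁ h₂ hs =>
    cases h₂ with
    | nu h =>
      obtain ⟨F', hs', e⟩ := hs.nu_right
      have h' := (h₁.rename Nat.succ_injective).sync h hs'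
      rw [← Multiset.map_add] at h'
      refine ⟨_, h'.nu, (e _ _).trans (.of_eq ?_)⟩
      simp only [Label.sw, rename_id]
    -- Here the restricted name is extruded to the receiver `P`. On the other side the same exchange
    -- is a free communication of the name `0` below the restriction.
    | opn h =>
      cases hs
      have h' := (h₁.rename Nat.succ_injective).sync h (.inp_out _ _)
      rw [← Multiset.map_add] at h'
      refine ⟨_, h'.nu, .of_eq ?_⟩
      simp only [Label.sw, rename_id]
      rw [Label.lift, rename_lift_succ_inst]

theorem nu_extr_symm (P Q : Proc) : Sim (nu (par P.up Q)) (par P (nu Q)) := by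
  intro κ L X h
  cases h with
  | nu h =>
    generalize eκ : κ.map Nat.succ = κ' at h
    generalize eL : L.map Nat.succ = L' at h
    cases h with
    | par_l _ h =>
      obtain ⟨μ, M, P', e₁, e₂, rfl, h'⟩ := LStep.of_rename h Nat.succ_injective
      obtain rfl := Label.map_succ_injective (eκ.trans e₁)
      obtain rfl := Multiset.map_injective Nat.succ_injective (eL.trans e₂)
      subst eκ
      refine ⟨_, h'.par_l _, NSC.trans (.of_eq ?_) (NSC.nu_extr _ _).symm⟩
      simp only [Proc.rename, up, rename_rename, Label.sh_map, Label.sw_comp_sh,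
        Label.sw_comp_lift_succ]
    | par_r _ h =>
      subst eκ eL
      refine ⟨_, h.nu.par_r _, NSC.trans (.of_eq ?_) (NSC.nu_extr _ _).symm⟩
      simp only [Proc.rename, up, rename_rename, Label.sh_map, ← Function.comp_assoc,
        Label.sw_comp_sh, lift_comp_succ]
    | sync h₁ h₂ hs =>
      obtain ⟨μ, M, P', rfl, rfl, rfl, h₁'⟩ := LStep.of_rename h₁ Nat.succ_injective
      rename_i L₂ _
      obtain rfl : κ = .tau := by cases κ <;> simp_all [Label.map]
      -- The whole step lacks only weakened names, so neither partner lacks an authorization for the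
      -- restricted name.
      obtain ⟨N, rfl⟩ := exists_eq_map_succ (L := L₂) (fun h0 => by
        have := Multiset.mem_add.2 (Or.inr h0 : 0 ∈ M.map Nat.succ ∨ 0 ∈ L₂)
        rw [← eL] at this
        simp at this)
      rw [← Multiset.map_add] at eL
      obtain rfl := Multiset.map_injective Nat.succ_injective eL
      simp only [Label.sw, rename_id]
      rcases hs.of_map_succ_left with ⟨ν, rfl⟩ | ⟨a, rfl, rfl⟩
      · obtain ⟨F₀, hs₀, -⟩ := hs.of_map Nat.succ_injective
        obtain ⟨F', hs', e⟩ := hs₀.nu_right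
        obtain rfl := hs.unique hs'
        exact ⟨_, h₁'.sync h₂.nu hs₀, (e _ _).symm⟩
      · cases hs
        refine ⟨_, h₁'.sync h₂.opn (.inp_bout a), .of_eq ?_⟩
        exact congrArg (fun X => nu (par X _)) (rename_lift_succ_inst _)
  | opn h =>
    generalize eκ : Label.out _ 0 = κ' at h
    generalize eL : L.map Nat.succ = L' at h
    cases h with
    | par_l _ h =>
      obtain ⟨μ, M, P', rfl, -⟩ := LStep.of_rename h Nat.succ_injective
      -- A weakened process cannot output the name `0`.
      cases μ <;> simp [Label.map] at eκ
    | par_r _ h =>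
      subst eκ eL
      refine ⟨_, h.opn.par_r _, .of_eq ?_⟩
      simp only [Label.sh, rename_id]
      rfl
    | sync => cases eκ

theorem scope_auth (a : Name) (P : Proc) : Sim (auth a (nu P)) (nu (auth (a + 1) P)) := by
  intro κ L X h
  cases h with
  | use h =>
    cases h with
    | nu h => rw [Multiset.map_cons] at h; exact ⟨_, h.use.nu, .refl _⟩
    | opn h => rw [Multiset.map_cons] at h; exact ⟨_, h.use.opn, .refl _⟩
  | keep h hc =>
    have hc' : a + 1 ∉ L.map Nat.succ := by simpa using hc
    cases h with
    | nu h =>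
      refine ⟨_, (h.keep hc').nu, (NSC.scope_auth _ _).trans (.of_eq ?_)⟩
      simp only [Proc.rename, Label.sh_map]
      exact congrArg (fun x => nu (auth x _)) (congrFun κ.sw_comp_sh (a + 1)).symm
    | opn h => exact ⟨_, (h.keep hc').opn, .refl _⟩

theorem scope_auth_symm (a : Name) (P : Proc) : Sim (nu (auth (a + 1) P)) (auth a (nu P)) := by
  intro κ L X h
  cases h with
  | nu h =>
    cases h with
    | use h => rw [← Nat.succ_eq_add_one, ← Multiset.map_cons] at h; exact ⟨_, h.nu.use, .refl _⟩
    | keep h hc =>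
      have hc' : a ∉ L := by simpa using hc
      refine ⟨_, h.nu.keep hc', NSC.trans (.of_eq ?_) (NSC.scope_auth _ _).symm⟩
      simp only [Proc.rename, Label.sh_map]
      exact congrArg (fun x => nu (auth x _)) (congrFun κ.sw_comp_sh (a + 1))
  | opn h =>
    cases h with
    | use h => rw [← Nat.succ_eq_add_one a, ← Multiset.map_cons] at h; exact ⟨_, h.opn.use, .refl _⟩
    | keep h hc =>
      have hc' : a ∉ L := by simpa using hc
      exact ⟨_, h.opn.keep hc', .refl _⟩

theorem auth_swap (a b : Name) (P : Proc) : Sim (auth a (auth b P)) (auth b (auth a P)) := by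
  intro κ L X h
  -- For distinct names, a scope on `a` that is kept when `L` is lacking is still kept when `b ::ₘ
  -- L` is lacking. For equal names this fails, but the two sides coincide.
  by_cases hab : a = b
  · subst hab; exact ⟨_, h, .refl _⟩
  cases h with
  | use h =>
    cases h with
    | use h => rw [Multiset.cons_swap] at h; exact ⟨_, h.use.use, .refl _⟩
    | keep h hc =>
      exact ⟨_, h.use.keep fun hb => hc (Multiset.mem_cons_of_mem hb), .refl _⟩
  | keep h ha =>
    cases h with
    | use h => exact ⟨_, (h.keep (by simp [hab, ha])).use, .refl _⟩
    | keep h hb => exact ⟨_, (h.keep ha).keep hb, .auth_swap _ _ _⟩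

theorem rep_unfold (a : Name) (P : Proc) : Sim (rep a P) (par (rep a P) (auth a (inp a P))) := by
  intro κ L X h
  cases h
  refine ⟨_, (LStep.rep a P).par_l _, ?_⟩
  exact (NSC.par_congr (.refl _) ((NSC.rep_unfold a P).rename _)).trans (NSC.par_assoc _ _ _).symm

/-- The unfolded input consumes the scope on `a` around it and then lacks nothing, just like the
replicated input itself. The scope cannot be kept, and two inputs do not communicate. -/
theorem rep_unfold_symm (a : Name) (P : Proc) :
    Sim (par (rep a P) (auth a (inp a P))) (rep a P) := by
  intro κ L X h
  cases h with
  | par_l _ h =>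
    cases h
    refine ⟨_, .rep a P, ?_⟩
    exact (NSC.par_assoc _ _ _).trans
      (NSC.par_congr (.refl _) ((NSC.rep_unfold a P).rename _).symm)
  | par_r _ h =>
    cases h with
    | use h =>
      generalize eL : a ::ₘ L = L' at h
      cases h
      obtain rfl : L = 0 := (Multiset.cons_inj_right a).1 eL
      exact ⟨_, .rep a P, .par_comm _ _⟩
    | keep h hc => cases h; simp at hc
  | sync h₁ h₂ hs =>
    cases h₁
    cases h₂ with
    | use h => generalize a ::ₘ _ = M at h; cases h; cases hs
    | keep h => cases h; cases hs

end Sim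

/-- Both directions are proved together because the congruence is closed under symmetry. Below
prefixes the induction hypothesis plays no role, since no step takes place there; the congruence of
the residuals is enough. -/
theorem NSC.sim {P Q : Proc} (h : NSC P Q) : Sim P Q ∧ Sim Q P := by
  induction h with
  | refl P => exact ⟨fun _ _ P' h => ⟨P', h, .refl _⟩, fun _ _ P' h => ⟨P', h, .refl _⟩⟩
  | symm _ ih => exact ih.symm
  | trans _ _ ih₁ ih₂ =>
    constructor
    · intro κ L X h
      obtain ⟨Y, h, e⟩ := ih₁.1 h
      obtain ⟨Z, h, e'⟩ := ih₂.1 h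
      exact ⟨Z, h, e.trans e'⟩
    · intro κ L X h
      obtain ⟨Y, h, e⟩ := ih₂.2 h
      obtain ⟨Z, h, e'⟩ := ih₁.2 h
      exact ⟨Z, h, e.trans e'⟩
  | par_congr e₁ e₂ ih₁ ih₂ =>
    exact ⟨.par_congr ih₁.1 ih₂.1 e₁ e₂, .par_congr ih₁.2 ih₂.2 e₁.symm e₂.symm⟩
  | nu_congr _ ih => exact ⟨.nu_congr ih.1, .nu_congr ih.2⟩
  | out_congr a b e _ =>
    exact ⟨fun _ _ _ h => by cases h; exact ⟨_, .out _ _ _, .auth_congr _ e⟩,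
      fun _ _ _ h => by cases h; exact ⟨_, .out _ _ _, .auth_congr _ e.symm⟩⟩
  | inp_congr a e _ =>
    exact ⟨fun _ _ _ h => by cases h; exact ⟨_, .inp _ _, .auth_congr _ e⟩,
      fun _ _ _ h => by cases h; exact ⟨_, .inp _ _, .auth_congr _ e.symm⟩⟩
  | auth_congr a _ ih => exact ⟨.auth_congr a ih.1, .auth_congr a ih.2⟩
  | sauth_congr a b e _ =>
    exact ⟨fun _ _ _ h => by cases h; exact ⟨_, .sauth _ _ _, .auth_congr _ e⟩,
      fun _ _ _ h => by cases h; exact ⟨_, .sauth _ _ _, .auth_congr _ e.symm⟩⟩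
  | rauth_congr a b e _ =>
    exact ⟨fun _ _ _ h => by cases h; exact ⟨_, .rauth _ _ _, .auth_congr _ (.auth_congr _ e)⟩,
      fun _ _ _ h => by cases h; exact ⟨_, .rauth _ _ _, .auth_congr _ (.auth_congr _ e.symm)⟩⟩
  | rep_congr a e _ =>
    exact ⟨fun _ _ _ h => by
        cases h
        exact ⟨_, .rep _ _, .par_congr (.auth_congr _ e) ((NSC.rep_congr a e).rename _)⟩,
      fun _ _ _ h => by
        cases h
        exact ⟨_, .rep _ _, .par_congr (.auth_congr _ e.symm) ((NSC.rep_congr a e.symm).rename _)⟩⟩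
  | par_inact P =>
    constructor
    · intro κ L X h
      cases h with
      | par_l _ h => exact ⟨_, h, .par_inact _⟩
      | par_r _ h => cases h
      | sync _ h => cases h
    · intro κ L X h
      exact ⟨_, h.par_l _, (NSC.par_inact _).symm⟩
  | par_comm P Q => exact ⟨.par_comm P Q, .par_comm Q P⟩
  | par_assoc P Q R => exact ⟨.par_assoc P Q R, .par_assoc_symm P Q R⟩
  | nu_inact =>
    refine ⟨fun _ _ _ h => ?_, fun _ _ _ h => by cases h⟩
    cases h with
    | nu h => cases h
    | opn h => cases h
  | nu_swap P =>
    refine ⟨.nu_swap P, ?_⟩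
    have := Sim.nu_swap (P.rename swp)
    rwa [rename_rename, swp_comp_swp, rename_id] at this
  | rep_unfold a P => exact ⟨.rep_unfold a P, .rep_unfold_symm a P⟩
  | nu_extr P Q => exact ⟨.nu_extr P Q, .nu_extr_symm P Q⟩
  | auth_swap a b P => exact ⟨.auth_swap a b P, .auth_swap b a P⟩
  | auth_inact a =>
    refine ⟨fun _ _ _ h => ?_, fun _ _ _ h => by cases h⟩
    cases h with
    | use h => cases h
    | keep h => cases h
  | scope_auth a P => exact ⟨.scope_auth a P, .scope_auth_symm a P⟩

/-! ### The labelled transitions and the late transitions -/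

/-- `Corr κ L x α`: the action `α` is the label `κ` that lacks the authorizations `L`, where `x` is the
name that is received or extruded. -/
inductive Corr : Label → Multiset Name → Name → Act → Prop
  | out (i : Fin 2) (a b x : Name) :
      Corr (.out a b) (Multiset.replicate (1 - (i : ℕ)) a) x (.out i a b)
  | inp (i : Fin 2) (a x : Name) :
      Corr (.inp a) (Multiset.replicate (1 - (i : ℕ)) a) x (.inp i a x)
  | sauth (i k : Fin 2) (a b x : Name) :
      Corr (.sauth a b) (Multiset.replicate (1 - (i : ℕ)) a + Multiset.replicate (1 - (k : ℕ)) b) x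
        (.sauth i k a b)
  | rauth (i : Fin 2) (a b x : Name) :
      Corr (.rauth a b) (Multiset.replicate (1 - (i : ℕ)) a) x (.rauth i a b)
  | bout (i : Fin 2) (a x : Name) (h : a ≠ x) :
      Corr (.bout a) (Multiset.replicate (1 - (i : ℕ)) a) x (.bout i a x)
  | tau (L : Multiset Name) (x : Name) : Corr .tau L x (.tau L)

/-! ### Annotations and lacking authorizations -/

namespace Corr

variable {κ : Label} {L : Multiset Name} {x c : Name} {α β : Act}

theorem exists_of_carry (h : Corr κ L x α) (hc : Act.Carry c α β) :
    ∃ L', L = c ::ₘ L' ∧ Corr κ L' x β := by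
  cases hc <;> cases h
  · exact ⟨0, rfl, .out 1 _ _ _⟩
  · exact ⟨0, rfl, .inp 1 _ _⟩
  · exact ⟨0, rfl, .rauth 1 _ _ _⟩
  · exact ⟨0, rfl, .bout 1 _ _ (by assumption)⟩
  · rename_i k b
    exact ⟨Multiset.replicate (1 - (k : ℕ)) b, by simp, by simpa using Corr.sauth 1 k c b x⟩
  · rename_i i a
    exact ⟨Multiset.replicate (1 - (i : ℕ)) a, by simp [← Multiset.singleton_add, add_comm],
      by simpa using Corr.sauth i 1 a c x⟩

/-- Together with `exists_of_carry`, this identifies raising an exponent with deleting one copy from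
the lacking multiset, so that `use` on a visible label is `scope_ext`. Internal steps are excluded
because `scope_int` treats them. -/
theorem exists_carry (h : Corr κ (c ::ₘ L) x α) (hκ : κ ≠ .tau) :
    ∃ β, Act.Carry c α β ∧ Corr κ L x β := by
  generalize e : c ::ₘ L = M at h
  have single : ∀ {i : Fin 2} {a : Name}, c ::ₘ L = Multiset.replicate (1 - (i : ℕ)) a →
      i = 0 ∧ c = a ∧ L = 0 := by
    intro i a h
    fin_cases i
    · have : c ::ₘ L = a ::ₘ 0 := by simpa using h
      rcases Multiset.cons_eq_cons.1 this with ⟨h₁, h₂⟩ | ⟨-, cs, h₁, h₂⟩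
      · exact ⟨rfl, h₁, h₂⟩
      · exact absurd h₂.symm (Multiset.cons_ne_zero)
    · simp at h
  cases h with
  | out i a b => obtain ⟨rfl, rfl, rfl⟩ := single e; exact ⟨_, .out _ _, .out 1 _ _ _⟩
  | inp i a => obtain ⟨rfl, rfl, rfl⟩ := single e; exact ⟨_, .inp _ _, .inp 1 _ _⟩
  | rauth i a b => obtain ⟨rfl, rfl, rfl⟩ := single e; exact ⟨_, .rauth _ _, .rauth 1 _ _ _⟩
  | bout i a _ h => obtain ⟨rfl, rfl, rfl⟩ := single e; exact ⟨_, .bout _ _, .bout 1 _ _ h⟩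
  | tau => exact absurd rfl hκ
  | sauth i k a b =>
    have hc : c ∈ Multiset.replicate (1 - (i : ℕ)) a + Multiset.replicate (1 - (k : ℕ)) b := by
      rw [← e]; simp
    rcases Multiset.mem_add.1 hc with hc | hc
    · obtain rfl := Multiset.eq_of_mem_replicate hc
      fin_cases i
      · have : c ::ₘ L = c ::ₘ Multiset.replicate (1 - (k : ℕ)) b := by simpa using e
        obtain rfl := (Multiset.cons_inj_right c).1 this
        exact ⟨_, .sauth_subject _ _ _, by simpa using Corr.sauth 1 k c b x⟩
      · simp at hc
    · obtain rfl := Multiset.eq_of_mem_replicate hc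
      fin_cases k
      · have : c ::ₘ L = c ::ₘ Multiset.replicate (1 - (i : ℕ)) a := by
          simpa [← Multiset.singleton_add, add_comm] using e
        obtain rfl := (Multiset.cons_inj_right c).1 this
        exact ⟨_, .sauth_object _ _ _, by simpa using Corr.sauth i 1 a c x⟩
      · simp at hc

/-- The two negative premises of `Step.scope` say precisely that `c` is not lacking; `ne_tau` and
`not_carry` give the converse. -/
theorem notMem (h : Corr κ L x α) (h₁ : ∀ ω, α ≠ .tau (c ::ₘ ω)) (h₂ : ∀ β, ¬ Act.Carry c α β) :
    c ∉ L := by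
  intro hc
  obtain ⟨M, rfl⟩ := Multiset.exists_cons_of_mem hc
  by_cases hκ : κ = .tau
  · subst hκ
    cases h
    exact h₁ _ rfl
  · obtain ⟨β, hβ, -⟩ := h.exists_carry hκ
    exact h₂ β hβ

theorem ne_tau (h : Corr κ L x α) (hc : c ∉ L) (ω : Multiset Name) : α ≠ .tau (c ::ₘ ω) := by
  rintro rfl
  cases h
  simp at hc

theorem not_carry (h : Corr κ L x α) (hc : c ∉ L) (β : Act) : ¬ Act.Carry c α β := by
  intro hβ
  obtain ⟨L', rfl, -⟩ := h.exists_of_carry hβ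
  simp at hc

theorem bn (h : Corr κ L x α) {y : Name} (hy : y ∈ α.bn) : y = x ∧ ∃ a, κ = .bout a ∧ a ≠ x := by
  cases h <;> simp [Act.bn] at hy
  exact ⟨hy, _, rfl, by assumption⟩

theorem subject_ne {i : Fin 2} {a b : Name} (h : Corr κ L x (.bout i a b)) : a ≠ b := by
  cases h
  assumption

theorem names_subset (h : Corr κ L x α) : κ.names ⊆ α.names := by
  cases h <;> simp [Label.names, Act.names]

theorem mem_names (h : Corr κ L x α) {c : Name} (hc : c ∈ L) : c ∈ α.names := by
  cases h
  case tau => exact hc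
  case sauth =>
    rcases Multiset.mem_add.1 hc with hc | hc <;> simp [Act.names, Multiset.eq_of_mem_replicate hc]
  all_goals simp [Act.names, Multiset.eq_of_mem_replicate hc]

theorem names_or (h : Corr κ L x α) {c : Name} (hc : c ∈ α.names) : c ∈ κ.names ∨ c ∈ L ∨ c = x := by
  cases h <;> simp_all [Label.names, Act.names]
  all_goals tauto

theorem carry_bn (h : Act.Carry c α β) : β.bn = α.bn := by cases h <;> rfl

/-- Instantiating a residual and then restricting `a` is the same as restricting first and
instantiating afterwards. For inputs and bound outputs this needs `x ≠ a`, which holds because `x`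
is a name of the action. -/
theorem closeMap_comp_ins (h : Corr κ L x α) {a : Name} (ha : a ∉ α.names) :
    closeMap a ∘ κ.ins x = Proc.lift (κ.ins x) ∘ κ.sw ∘ κ.lift (closeMap a) := by
  have key : x ≠ a → closeMap a ∘ ncons x id =
      Proc.lift (ncons x id) ∘ swp ∘ Proc.lift (closeMap a) := by
    intro hx
    funext n
    cases n with
    | zero => simp [closeMap, hx, Proc.lift, swp, ncons]
    | succ n =>
      by_cases hn : n = a <;> simp [closeMap, hn, Proc.lift, swp, ncons]
  cases h <;> simp only [Act.names, Set.mem_insert_iff, Set.mem_singleton_iff, not_or] at ha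
  case inp => exact key (Ne.symm ha.2)
  case bout => exact key (Ne.symm ha.2)
  all_goals exact congrArg (· ∘ closeMap a) Proc.lift_id.symm

end Corr

/-- Each partner of a communication has to supply one authorization for the subject. Since the
exponents are at most one, the truncated subtractions are exact. -/
theorem replicate_two_sub (i j : Fin 2) (a : Name) :
    Multiset.replicate (2 - (i : ℕ) - (j : ℕ)) a =
      Multiset.replicate (1 - (i : ℕ)) a + Multiset.replicate (1 - (j : ℕ)) a := by
  rw [← Multiset.replicate_add]
  congr 1
  omega

theorem Label.ins_comp_sh (κ : Label) (x : Name) : κ.ins x ∘ κ.sh = id := by cases κ <;> rfl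

theorem Label.map_congr {κ : Label} {f g : Name → Name} (h : ∀ n ∈ κ.names, f n = g n) :
    κ.map f = κ.map g := by
  cases κ <;> simp_all [Label.map, Label.names]

/-- The disjointness of bound and free names is an invariant carried through the induction. In the
closing rules it makes the extruded name fresh for its sender, so that instantiating the residual at
this name and closing it again has no effect (`clos`). -/
theorem Step.lstep {P Q : Proc} {α : Act} (h : Step P α Q) :
    α.bn ∩ P.fn = ∅ ∧
      ∃ κ L x Q', Corr κ L x α ∧ LStep P κ L Q' ∧ Q = Q'.rename (κ.ins x) := by
  have disj : ∀ {A S T : Set Name}, A ∩ S = ∅ → A ∩ T = ∅ → A ∩ (S ∪ T) = ∅ := by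
    intro A S T h₁ h₂
    rw [Set.inter_union_distrib_left, h₁, h₂, Set.union_empty]
  have clos : ∀ {P P' : Proc} {κ : Label} {L : Multiset Name} {a : Name}, LStep P κ L P' →
      κ.sh = Nat.succ → a ∉ P.fn → close a (P'.rename (ncons a id)) = P' := by
    intro P P' κ L a h hκ ha
    refine close_inst P' a fun h' => ha (h.fn.2.2 a ?_)
    rwa [hκ]
  induction h with
  | out a b P =>
    exact ⟨by simp [Act.bn], _, _, 0, _, .out 0 _ _ _, .out a b P, (rename_id _).symm⟩
  | inp a x b P =>
    refine ⟨by simp [Act.bn], _, _, b, _, .inp 0 _ _, .inp a (close x P), ?_⟩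
    rw [subst_eq]
    rfl
  | out_a a b P =>
    exact ⟨by simp [Act.bn], _, _, 0, _, .sauth 0 0 _ _ _, .sauth a b P, (rename_id _).symm⟩
  | in_a a b P =>
    exact ⟨by simp [Act.bn], _, _, 0, _, .rauth 0 _ _ _, .rauth a b P, (rename_id _).symm⟩
  | in_rep a x b P =>
    refine ⟨by simp [Act.bn], _, _, b, _, .inp 1 _ _, .rep a (close x P), ?_⟩
    rw [subst_eq]
    exact congrArg (par _) (inst_up _ b).symm
  | par_l R _ hR ih =>
    obtain ⟨hP, κ, L, x, Q', hc, h, rfl⟩ := ih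
    refine ⟨disj hP hR, κ, L, x, _, hc, h.par_l R, ?_⟩
    simp only [Proc.rename, rename_rename, Label.ins_comp_sh, rename_id]
  | par_r R _ hR ih =>
    obtain ⟨hP, κ, L, x, Q', hc, h, rfl⟩ := ih
    refine ⟨disj hR hP, κ, L, x, _, hc, h.par_r R, ?_⟩
    simp only [Proc.rename, rename_rename, Label.ins_comp_sh, rename_id]
  | @res P Q α a _ ha ih =>
    obtain ⟨hP, κ, L, x, Q', hc, h, rfl⟩ := ih
    have h' := h.rename (closeMap_injective a)
    -- Away from `a`, closing is plain weakening, and `a` occurs neither in the label nor among the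
    -- lacking names.
    have e₁ : κ.map (closeMap a) = κ.map Nat.succ := Label.map_congr fun n hn =>
      if_neg fun (e : n = a) => ha (e ▸ hc.names_subset hn)
    have e₂ : L.map (closeMap a) = L.map Nat.succ := Multiset.map_congr rfl fun n hn =>
      if_neg fun (e : n = a) => ha (e ▸ hc.mem_names hn)
    rw [e₁, e₂] at h'
    refine ⟨?_, κ, L, x, _, hc, LStep.nu (P := close a P) h', ?_⟩
    · rw [Set.eq_empty_iff_forall_notMem] at hP ⊢
      rintro n ⟨h₁, h₂⟩
      have h₂ : n ∈ {n | n + 1 ∈ (close a P).fn} := h₂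
      rw [fn_nu_close] at h₂
      exact hP n ⟨h₁, h₂.1⟩
    · simp only [Proc.rename, rename_rename]
      rw [← hc.closeMap_comp_ins ha, ← rename_rename]
      rfl
  | @opn P Q i a b _ hab ih =>
    obtain ⟨-, κ, L, x, Q', hc, h, rfl⟩ := ih
    cases hc
    have h' := h.rename (closeMap_injective b)
    refine ⟨?_, _, _, b, _, .bout i a b hab, LStep.opn (P := close b P)
      (P' := Q'.rename (closeMap b)) ?_, ?_⟩
    · rw [Set.eq_empty_iff_forall_notMem]
      rintro n ⟨h₁, h₂⟩
      have h₂ : n ∈ {n | n + 1 ∈ (close b P).fn} := h₂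
      rw [fn_nu_close] at h₂
      exact h₂.2 h₁
    · change LStep (P.rename (closeMap b)) _ _ _
      simpa [Label.map, Label.lift, Label.ins, rename_id, closeMap, hab] using h'
    · exact (rename_id Q').trans (inst_close Q' b).symm
  | @scope_int P Q ω a _ ih =>
    obtain ⟨-, κ, L, x, Q', hc, h, rfl⟩ := ih
    cases hc
    exact ⟨by simp [Act.bn], _, _, x, _, .tau _ _, h.use, rfl⟩
  | @scope_ext P Q α β a _ hβ ih =>
    obtain ⟨hP, κ, L, x, Q', hc, h, rfl⟩ := ih
    obtain ⟨L, rfl, hc'⟩ := hc.exists_of_carry hβ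
    refine ⟨?_, _, _, x, _, hc', h.use, rfl⟩
    rw [Corr.carry_bn hβ]
    refine disj ?_ hP
    rw [Set.inter_singleton_eq_empty]
    intro ha
    cases hβ <;> simp only [Act.bn, Set.mem_empty_iff_false, Set.mem_singleton_iff] at ha
    exact hc.subject_ne ha
  | @scope P Q α a _ h₁ h₂ ha ih =>
    obtain ⟨hP, κ, L, x, Q', hc, h, rfl⟩ := ih
    refine ⟨disj (Set.inter_singleton_eq_empty.2 ha) hP, _, _, x, _, hc,
      h.keep (hc.notMem h₁ h₂), ?_⟩
    exact congrArg (auth · _) (congrFun (κ.ins_comp_sh x) a).symm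
  | comm_l _ _ ih₁ ih₂ =>
    obtain ⟨-, κ₁, L₁, x₁, P', hc₁, h₁, rfl⟩ := ih₁
    obtain ⟨-, κ₂, L₂, x₂, Q', hc₂, h₂, rfl⟩ := ih₂
    cases hc₁
    cases hc₂
    rw [replicate_two_sub]
    refine ⟨by simp [Act.bn], _, _, 0, _, .tau _ _, h₁.sync h₂ (.out_inp _ _), ?_⟩
    simp only [Label.ins, rename_id]; rfl
  | comm_r _ _ ih₁ ih₂ =>
    obtain ⟨-, κ₁, L₁, x₁, P', hc₁, h₁, rfl⟩ := ih₁
    obtain ⟨-, κ₂, L₂, x₂, Q', hc₂, h₂, rfl⟩ := ih₂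
    cases hc₁
    cases hc₂
    rw [replicate_two_sub, add_comm]
    refine ⟨by simp [Act.bn], _, _, 0, _, .tau _ _, h₂.sync h₁ (.inp_out _ _), ?_⟩
    simp only [Label.ins, rename_id]; rfl
  | @close_l P P' Q Q' i j a b _ _ ha ih₁ ih₂ =>
    obtain ⟨hP, κ₁, L₁, x₁, P', hc₁, h₁, rfl⟩ := ih₁
    obtain ⟨-, κ₂, L₂, x₂, Q', hc₂, h₂, rfl⟩ := ih₂
    cases hc₁
    cases hc₂
    have hP : a ∉ P.fn := fun h => (Set.eq_empty_iff_forall_notMem.1 hP) a ⟨rfl, h⟩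
    rw [replicate_two_sub]
    refine ⟨by simp [Act.bn], _, _, 0, _, .tau _ _, h₁.sync h₂ (.bout_inp _), ?_⟩
    simp only [Label.ins, rename_id]
    exact congrArg₂ (fun X Y => nu (par X Y)) (clos h₁ rfl hP) (clos h₂ rfl ha)
  | @close_r P P' Q Q' i j a b _ _ ha ih₁ ih₂ =>
    obtain ⟨hP, κ₁, L₁, x₁, P', hc₁, h₁, rfl⟩ := ih₁
    obtain ⟨-, κ₂, L₂, x₂, Q', hc₂, h₂, rfl⟩ := ih₂
    cases hc₁
    cases hc₂
    have hP : a ∉ P.fn := fun h => (Set.eq_empty_iff_forall_notMem.1 hP) a ⟨rfl, h⟩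
    rw [replicate_two_sub, add_comm]
    refine ⟨by simp [Act.bn], _, _, 0, _, .tau _ _, h₂.sync h₁ (.inp_bout _), ?_⟩
    simp only [Label.ins, rename_id]
    exact congrArg₂ (fun X Y => nu (par X Y)) (clos h₂ rfl ha) (clos h₁ rfl hP)
  | auth_l _ _ ih₁ ih₂ =>
    obtain ⟨-, κ₁, L₁, x₁, P', hc₁, h₁, rfl⟩ := ih₁
    obtain ⟨-, κ₂, L₂, x₂, Q', hc₂, h₂, rfl⟩ := ih₂
    cases hc₁
    cases hc₂
    rw [replicate_two_sub, add_right_comm]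
    refine ⟨by simp [Act.bn], _, _, 0, _, .tau _ _, h₁.sync h₂ (.sauth_rauth _ _), ?_⟩
    simp only [Label.ins, rename_id]
  | auth_r _ _ ih₁ ih₂ =>
    obtain ⟨-, κ₁, L₁, x₁, P', hc₁, h₁, rfl⟩ := ih₁
    obtain ⟨-, κ₂, L₂, x₂, Q', hc₂, h₂, rfl⟩ := ih₂
    cases hc₁
    cases hc₂
    rw [replicate_two_sub, add_right_comm, add_comm]
    refine ⟨by simp [Act.bn], _, _, 0, _, .tau _ _, h₂.sync h₁ (.rauth_sauth _ _), ?_⟩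
    simp only [Label.ins, rename_id]

/-! ### From late steps back to labelled transitions -/

theorem Step.inp_nameless (a x : Name) (R : Proc) :
    Step (Proc.inp a R) (.inp 0 a x) (Proc.auth a (R.inst x)) := by
  obtain ⟨y, hy⟩ := exists_fresh (finite_pred R.finite_fn) id
  have e : close y (R.inst y) = R := close_inst R y fun h => hy y h rfl
  have := Step.inp a y x (R.inst y)
  rwa [subst_eq, input, e] at this

theorem Step.rep_nameless (a x : Name) (R : Proc) :
    Step (Proc.rep a R) (.inp 1 a x) (Proc.par (Proc.auth a (R.inst x)) (Proc.rep a R)) := by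
  obtain ⟨y, hy⟩ := exists_fresh (finite_pred R.finite_fn) id
  have e : close y (R.inst y) = R := close_inst R y fun h => hy y h rfl
  have := Step.in_rep a y x (R.inst y)
  rwa [subst_eq, repInput, e] at this

theorem Proc.inst_rename (P : Proc) (b : Name) (f : Name → Name) :
    (P.inst b).rename f = (P.rename (Proc.lift f)).rename (ncons (f b) id) := by
  simp only [inst, rename_rename]
  exact rename_ext fun n => by cases n <;> rfl

/-- The renaming allows nameless restrictions to be opened with concrete names. Injectivity is
required only on the free names, because `ncons a f` has it only there. The name `x` is arbitrary
for an input, as labelled inputs are early, but must be fresh for a bound output. -/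
theorem LStep.step_rename {P Q : Proc} {κ : Label} {L : Multiset Name} (h : LStep P κ L Q)
    {f : Name → Name} (hf : Set.InjOn f P.fn) {x : Name}
    (hx : ∀ a, κ = .bout a → x ∉ (P.rename f).fn) :
    ∃ α, Corr (κ.map f) (L.map f) x α ∧
      Step (P.rename f) α ((Q.rename (κ.lift f)).rename (κ.ins x)) := by
  have sh_cancel : ∀ (κ : Label) (R : Proc) (f : Name → Name) (x : Name),
      ((R.rename κ.sh).rename (κ.lift f)).rename (κ.ins x) = R.rename f := by
    intro κ R f x
    rw [rename_rename, rename_rename]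
    exact rename_ext fun n => by cases κ <;> rfl
  have bn_par : ∀ {P : Proc} {κ : Label} {L : Multiset Name} {f : Name → Name} {x : Name} {α : Act},
      Corr (κ.map f) L x α → (∀ a, κ = .bout a → x ∉ P.fn) → α.bn ∩ P.fn = ∅ := by
    intro P κ L f x α hc hx
    rw [Set.eq_empty_iff_forall_notMem]
    rintro y ⟨hy, hy'⟩
    obtain ⟨rfl, a, e, -⟩ := hc.bn hy
    cases κ <;> simp only [Label.map, reduceCtorEq] at e
    exact hx _ rfl hy'
  induction h generalizing f x with
  | out a b P =>
    exact ⟨_, by simpa [Label.map] using Corr.out 0 (f a) (f b) x, by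
      simp only [Label.ins, rename_id]; exact Step.out (f a) (f b) (P.rename f)⟩
  | inp a P =>
    exact ⟨_, by simpa [Label.map] using Corr.inp 0 (f a) x, Step.inp_nameless _ _ _⟩
  | sauth a b P =>
    exact ⟨_, by simpa [Label.map] using Corr.sauth 0 0 (f a) (f b) x, by
      simp only [Label.ins, rename_id]; exact Step.out_a (f a) (f b) (P.rename f)⟩
  | rauth a b P =>
    exact ⟨_, by simpa [Label.map] using Corr.rauth 0 (f a) (f b) x, by
      simp only [Label.ins, rename_id]; exact Step.in_a (f a) (f b) (P.rename f)⟩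
  | rep a P =>
    refine ⟨_, by simpa [Label.map] using Corr.inp 1 (f a) x, ?_⟩
    have e := sh_cancel (.inp a) (Proc.rep a P) f x
    have key := Step.rep_nameless (f a) x (P.rename (Proc.lift f))
    exact cast (congrArg (Step _ _) (congrArg (Proc.par _) e.symm)) key
  | @par_l P P' κ L R _ ih =>
    obtain ⟨α, hc, h⟩ := ih (hf.mono Set.subset_union_left)
      (fun a e h => hx a e (Or.inl h))
    refine ⟨α, hc, ?_⟩
    have := h.par_l (R.rename f) (bn_par hc fun a e h => hx a e (Or.inr h))
    simpa only [Proc.rename, sh_cancel] using this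
  | @par_r P P' κ L R _ ih =>
    obtain ⟨α, hc, h⟩ := ih (hf.mono Set.subset_union_right)
      (fun a e h => hx a e (Or.inr h))
    refine ⟨α, hc, ?_⟩
    have := h.par_r (R.rename f) (bn_par hc fun a e h => hx a e (Or.inl h))
    simpa only [Proc.rename, sh_cancel] using this
  | @nu P Q κ L h ih =>
    have hfn := h.nu.fn
    -- The name chosen for the restriction must avoid the renamed process, the name `x`, and the
    -- renamed residual. The latter is read with one or with two slots removed, according to whether
    -- the label adds a binder.
    obtain ⟨a, ha⟩ := (((P.nu.finite_fn.image f).union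
      ((finite_pred Q.finite_fn).image f)).union
      (((finite_pred (finite_pred Q.finite_fn)).image f).union
        (Set.finite_singleton x))).exists_notMem
    simp only [Set.mem_union, not_or, Set.mem_singleton_iff] at ha
    obtain ⟨⟨haP, haQ⟩, haQ', hax⟩ := ha
    have inj : Set.InjOn (ncons a f) P.fn := by
      rintro (_ | m) hm (_ | n) hn e
      · rfl
      · exact absurd ⟨n, hn, e.symm⟩ haP
      · exact absurd ⟨m, hm, e⟩ haP
      · exact congrArg _ (hf hm hn e)
    obtain ⟨α, hc, h⟩ := ih inj (x := x) (by
      intro b e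
      cases κ <;> simp only [Label.map, reduceCtorEq] at e
      have := hx _ rfl
      rw [fn_rename] at this ⊢
      rintro ⟨_ | m, hm, e⟩
      · exact hax e
      · exact this ⟨m, hm, e⟩)
    simp only [Label.map_map, Multiset.map_map, ncons_comp_succ, Label.lift_map, Label.ins_map]
      at hc h
    have haα : a ∉ α.names := by
      intro haα
      rcases hc.names_or haα with h | h | h
      · refine haP (Set.image_mono hfn.1 ?_)
        cases κ <;> simp_all [Label.names, Label.map, Set.image_insert_eq]
      · obtain ⟨n, hn, rfl⟩ := Multiset.mem_map.1 h
        exact haP ⟨n, hfn.2.1 n hn, rfl⟩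
      · exact hax h
    refine ⟨α, hc, ?_⟩
    have key := h.res a haα
    rw [← nu_rename_eq_res P f a fun n hn e => haP ⟨n, hn, e⟩] at key
    refine cast (congrArg (Step _ α) (congrArg Proc.nu ?_)) key
    simp only [close, rename_rename]
    refine Eq.symm (rename_congr _ _ _ fun n hn => ?_)
    have arity_zero : Proc.lift f n = (if ncons a f n = a then 0 else ncons a f n + 1) := by
      cases n with
      | zero => simp [Proc.lift, ncons]
      | succ n =>
        have : f n ≠ a := fun e => haQ ⟨n, hn, e⟩
        simp [Proc.lift, ncons, this]
    have arity_one : Proc.lift (ncons x id) (Proc.lift (Proc.lift f) (swp n)) =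
        (if ncons x id (Proc.lift (ncons a f) n) = a then 0
          else ncons x id (Proc.lift (ncons a f) n) + 1) := by
      rcases n with _ | _ | n
      · simp [Proc.lift, ncons, swp, Ne.symm hax]
      · simp [Proc.lift, ncons, swp]
      · have : f n ≠ a := fun e => haQ' ⟨n, hn, e⟩
        simp [Proc.lift, ncons, swp, this]
    cases κ
    case inp => exact arity_one
    case bout => exact arity_one
    all_goals
      simp only [Label.ins, Label.lift, Label.sw, Proc.lift_id, Function.comp, id]
      exact arity_zero
  | @opn P Q a L h ih =>
    have hfn := h.opn.fn
    have hx' := hx a rfl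
    rw [fn_rename] at hx'
    -- The restriction is opened with `x` itself, which then is the extruded name.
    have inj : Set.InjOn (ncons x f) P.fn := by
      rintro (_ | m) hm (_ | n) hn e
      · rfl
      · exact absurd ⟨n, hn, e.symm⟩ hx'
      · exact absurd ⟨m, hm, e⟩ hx'
      · exact congrArg _ (hf hm hn e)
    obtain ⟨α, hc, h⟩ := ih inj (x := x) (by simp)
    simp only [Label.map, Multiset.map_map, ncons_comp_succ, ncons] at hc
    generalize L.map f = M at hc ⊢
    have hax : f a ≠ x := fun e => hx' ⟨a, hfn.1 rfl, e⟩
    cases hc with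
    | out i =>
      refine ⟨_, .bout i (f a) x hax, ?_⟩
      have key := h.opn hax
      rw [← nu_rename_eq_res P f x fun n hn e => hx' ⟨n, hn, e⟩] at key
      refine cast (congrArg (Step _ _) ?_) key
      simp only [Label.lift, Label.ins, rename_rename, rename_id]
      exact rename_ext fun n => by cases n <;> rfl
  | @use P Q κ L c h ih =>
    obtain ⟨α, hc, h⟩ := ih (hf.mono Set.subset_union_right) (fun a e h => hx a e (Or.inr h))
    rw [Multiset.map_cons] at hc
    by_cases hκ : κ = .tau
    · subst hκ
      cases hc
      exact ⟨_, .tau _ _, .scope_int h⟩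
    · obtain ⟨β, hβ, hc'⟩ := hc.exists_carry (by cases κ <;> simp_all [Label.map])
      exact ⟨β, hc', .scope_ext h hβ⟩
  | @keep P Q κ L c h hcL ih =>
    have hfn := h.fn
    obtain ⟨α, hc, h⟩ := ih (hf.mono Set.subset_union_right) (fun a e h => hx a e (Or.inr h))
    have hcL' : f c ∉ L.map f := by
      intro hm
      obtain ⟨n, hn, e⟩ := Multiset.mem_map.1 hm
      exact hcL (hf (Or.inr (hfn.2.1 n hn)) (Or.inl rfl) e ▸ hn)
    refine ⟨α, hc, ?_⟩
    have key := h.scope (f c) (hc.ne_tau hcL') (hc.not_carry hcL') (by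
      intro hb
      obtain ⟨e, a, e', -⟩ := hc.bn hb
      cases κ <;> simp only [Label.map, reduceCtorEq] at e'
      exact hx _ rfl (Or.inl e.symm))
    refine cast (congrArg (Step _ α) ?_) key
    exact congrArg (Proc.auth · _) (by cases κ <;> rfl)
  | @sync P P' Q Q' κ₁ κ₂ L₁ L₂ F h₁ h₂ hs ih₁ ih₂ =>
    have hfP := hf.mono (Set.subset_union_left (t := Q.fn))
    have hfQ := hf.mono (Set.subset_union_right (s := P.fn))
    have hfn₁ := h₁.fn
    have hfn₂ := h₂.fn
    simp only [Label.map, Label.lift, Label.ins, rename_id, Multiset.map_add]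
    -- In the extrusion cases `y` is the name on which the bound output and the early input agree.
    obtain ⟨y, hyP, hyQ⟩ : ∃ y, y ∉ (P.rename f).fn ∧ y ∉ (Q.rename f).fn := by
      obtain ⟨y, hy⟩ := ((P.rename f).finite_fn.union (Q.rename f).finite_fn).exists_notMem
      exact ⟨y, fun h => hy (Or.inl h), fun h => hy (Or.inr h)⟩
    have clos : ∀ {R R' : Proc}, (∀ n, n + 1 ∈ R'.fn → n ∈ R.fn) → y ∉ (R.rename f).fn →
        close y ((R'.rename (Proc.lift f)).rename (ncons y id)) = R'.rename (Proc.lift f) := by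
      intro R R' h hy
      refine close_inst _ _ fun hm => ?_
      rw [fn_rename] at hm hy
      obtain ⟨m, hm, e⟩ := hm
      obtain ⟨k, rfl, rfl⟩ := lift_eq_succ e.symm
      exact hy ⟨k, h k hm, rfl⟩
    cases hs with
    | out_inp a b =>
      obtain ⟨α, hc₁, s₁⟩ := ih₁ hfP (x := 0) (by simp)
      -- The early input is made to receive the very name that the partner sends.
      obtain ⟨β, hc₂, s₂⟩ := ih₂ hfQ (x := f b) (by simp)
      simp only [Label.map, Label.lift, Label.ins, rename_id] at hc₁ hc₂ s₁ s₂
      generalize L₁.map f = M₁ at hc₁ ⊢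
      generalize L₂.map f = M₂ at hc₂ ⊢
      cases hc₁
      cases hc₂
      rw [← replicate_two_sub]
      refine ⟨_, .tau _ _, ?_⟩
      rw [← inst_rename] at s₂
      exact s₁.comm_l s₂
    | inp_out a b =>
      obtain ⟨α, hc₁, s₁⟩ := ih₁ hfP (x := f b) (by simp)
      obtain ⟨β, hc₂, s₂⟩ := ih₂ hfQ (x := 0) (by simp)
      simp only [Label.map, Label.lift, Label.ins, rename_id] at hc₁ hc₂ s₁ s₂
      generalize L₁.map f = M₁ at hc₁ ⊢
      generalize L₂.map f = M₂ at hc₂ ⊢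
      cases hc₁
      cases hc₂
      rw [add_comm, ← replicate_two_sub]
      refine ⟨_, .tau _ _, ?_⟩
      rw [← inst_rename] at s₁
      exact s₂.comm_r s₁
    | sauth_rauth a b =>
      obtain ⟨α, hc₁, s₁⟩ := ih₁ hfP (x := 0) (by simp)
      obtain ⟨β, hc₂, s₂⟩ := ih₂ hfQ (x := 0) (by simp)
      simp only [Label.map, Label.lift, Label.ins, rename_id] at hc₁ hc₂ s₁ s₂
      generalize L₁.map f = M₁ at hc₁ ⊢
      generalize L₂.map f = M₂ at hc₂ ⊢
      cases hc₁
      cases hc₂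
      rw [add_right_comm, ← replicate_two_sub]
      exact ⟨_, .tau _ _, s₁.auth_l s₂⟩
    | rauth_sauth a b =>
      obtain ⟨α, hc₁, s₁⟩ := ih₁ hfP (x := 0) (by simp)
      obtain ⟨β, hc₂, s₂⟩ := ih₂ hfQ (x := 0) (by simp)
      simp only [Label.map, Label.lift, Label.ins, rename_id] at hc₁ hc₂ s₁ s₂
      generalize L₁.map f = M₁ at hc₁ ⊢
      generalize L₂.map f = M₂ at hc₂ ⊢
      cases hc₁
      cases hc₂
      rw [add_comm, add_right_comm, ← replicate_two_sub]
      exact ⟨_, .tau _ _, s₂.auth_r s₁⟩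
    | bout_inp a =>
      obtain ⟨α, hc₁, s₁⟩ := ih₁ hfP (x := y) (fun _ _ => hyP)
      obtain ⟨β, hc₂, s₂⟩ := ih₂ hfQ (x := y) (by simp)
      simp only [Label.map, Label.lift, Label.ins] at hc₁ hc₂ s₁ s₂
      generalize L₁.map f = M₁ at hc₁ ⊢
      generalize L₂.map f = M₂ at hc₂ ⊢
      cases hc₁
      cases hc₂
      rw [← replicate_two_sub]
      refine ⟨_, .tau _ _, ?_⟩
      refine cast (congrArg (Step _ _) ?_) (s₁.close_l s₂ hyQ)
      exact congrArg₂ (fun X Y => Proc.nu (Proc.par X Y))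
        (clos hfn₁.2.2 hyP) (clos hfn₂.2.2 hyQ)
    | inp_bout a =>
      obtain ⟨α, hc₁, s₁⟩ := ih₁ hfP (x := y) (by simp)
      obtain ⟨β, hc₂, s₂⟩ := ih₂ hfQ (x := y) (fun _ _ => hyQ)
      simp only [Label.map, Label.lift, Label.ins] at hc₁ hc₂ s₁ s₂
      generalize L₁.map f = M₁ at hc₁ ⊢
      generalize L₂.map f = M₂ at hc₂ ⊢
      cases hc₁
      cases hc₂
      rw [add_comm, ← replicate_two_sub]
      refine ⟨_, .tau _ _, ?_⟩
      refine cast (congrArg (Step _ _) ?_) (s₂.close_r s₁ hyP)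
      exact congrArg₂ (fun X Y => Proc.nu (Proc.par X Y))
        (clos hfn₁.2.2 hyP) (clos hfn₂.2.2 hyQ)

theorem Step.lstep_tau {P Q : Proc} {L : Multiset Name} (h : Step P (.tau L) Q) :
    LStep P .tau L Q := by
  obtain ⟨-, κ, M, x, Q', hc, h, rfl⟩ := h.lstep
  cases hc
  simpa only [Label.ins, rename_id] using h

theorem LStep.step_tau {P Q : Proc} {L : Multiset Name} (h : LStep P .tau L Q) :
    Step P (.tau L) Q := by
  obtain ⟨α, hc, h⟩ := h.step_rename (f := id) (fun _ _ _ _ h => h) (x := 0) (by simp)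
  cases hc
  simpa only [Label.ins, Label.lift, rename_id, Multiset.map_id] using h

/-! ### Contexts and drift -/

/-- Rename the names of a context. -/
def Ctx.rename (f : Name → Name) : Ctx → Ctx
  | .hole => .hole
  | .par R C => .par (R.rename f) (C.rename f)
  | .auth a C => .auth (f a) (C.rename f)

/-- Rename the names of a context with two holes. -/
def Ctx2.rename (f : Name → Name) : Ctx2 → Ctx2
  | .split C₁ C₂ => .split (C₁.rename f) (C₂.rename f)
  | .par R C => .par (R.rename f) (C.rename f)
  | .auth a C => .auth (f a) (C.rename f)

theorem Ctx.fill_rename (C : Ctx) (P : Proc) (f : Name → Name) :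
    (C.fill P).rename f = (C.rename f).fill (P.rename f) := by
  induction C <;> simp_all [Ctx.fill, Ctx.rename, Proc.rename]

theorem Ctx2.fill_rename (C : Ctx2) (P Q : Proc) (f : Name → Name) :
    (C.fill P Q).rename f = (C.rename f).fill (P.rename f) (Q.rename f) := by
  induction C <;> simp_all [Ctx2.fill, Ctx2.rename, Proc.rename, Ctx.fill_rename]

theorem Ctx.rename_rename (C : Ctx) (f g : Name → Name) :
    (C.rename f).rename g = C.rename (g ∘ f) := by
  induction C <;> simp_all [Ctx.rename, Proc.rename_rename]

theorem Ctx.rename_id (C : Ctx) : C.rename id = C := by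
  induction C <;> simp_all [Ctx.rename, Proc.rename_id]

theorem notMem_map_of_injOn {f : Name → Name} {S : Set Name} (hf : Set.InjOn f S)
    {d : Multiset Name} (hd : ∀ n ∈ d, n ∈ S) {c : Name} (hc : c ∈ S) (h : c ∉ d) :
    f c ∉ d.map f := by
  intro hm
  obtain ⟨n, hn, e⟩ := Multiset.mem_map.1 hm
  exact h (hf (hd n hn) hc e ▸ hn)

/-- Injectivity keeps a skipped scope skippable, and it matters only on the names of the context and
of the scopes already removed. This lets `NormRed.exists_finite` require injectivity on a finite set
only. -/
theorem Drift.rename {C C' : Ctx} {a d : Multiset Name} (h : Drift C a d C') {f : Name → Name}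
    {S : Set Name} (hf : Set.InjOn f S) (hC : (C.fill nil).fn ⊆ S) (hd : ∀ n ∈ d, n ∈ S) :
    Drift (C.rename f) (a.map f) (d.map f) (C'.rename f) := by
  induction h with
  | done d => exact .done _
  | @rem C C' a d c _ ih =>
    have hc : c ∈ S := hC (Or.inl rfl)
    have := ih (fun n hn => hC (Or.inr hn)) (by simp [hc]; exact hd)
    rw [Multiset.map_cons] at this ⊢
    exact this.rem
  | @skip C C' a d c _ hcd ih =>
    have hc : c ∈ S := hC (Or.inl rfl)
    exact (ih (fun n hn => hC (Or.inr hn)) hd).skip (notMem_map_of_injOn hf hd hc hcd)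
  | par _ ih => exact (ih (fun n hn => hC (Or.inr hn)) hd).par

theorem Drift2.rename {C C' : Ctx2} {a b d e : Multiset Name} (h : Drift2 C a b d e C')
    {f : Name → Name} {S : Set Name} (hf : Set.InjOn f S) (hC : (C.fill nil nil).fn ⊆ S)
    (hd : ∀ n ∈ d, n ∈ S) (he : ∀ n ∈ e, n ∈ S) :
    Drift2 (C.rename f) (a.map f) (b.map f) (d.map f) (e.map f) (C'.rename f) := by
  induction h with
  | spl h₁ h₂ =>
    exact .spl (h₁.rename hf (fun n hn => hC (Or.inl hn)) hd)
      (h₂.rename hf (fun n hn => hC (Or.inr hn)) he)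
  | @rem_l C C' a b d e c _ ih =>
    have hc : c ∈ S := hC (Or.inl rfl)
    have := ih (fun n hn => hC (Or.inr hn)) (by simp [hc]; exact hd) he
    rw [Multiset.map_cons] at this ⊢
    exact this.rem_l
  | @rem_r C C' a b d e c _ ih =>
    have hc : c ∈ S := hC (Or.inl rfl)
    have := ih (fun n hn => hC (Or.inr hn)) hd (by simp [hc]; exact he)
    rw [Multiset.map_cons] at this ⊢
    exact this.rem_r
  | @skip C C' a b d e c _ hcd hce ih =>
    have hc : c ∈ S := hC (Or.inl rfl)
    exact (ih (fun n hn => hC (Or.inr hn)) hd he).skip (notMem_map_of_injOn hf hd hc hcd)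
      (notMem_map_of_injOn hf he hc hce)
  | par _ ih => exact (ih (fun n hn => hC (Or.inr hn)) hd he).par

/-! ### Reductions are steps -/

/-- A removed scope is a `use` and a skipped scope is a `keep` with the same side condition. The
prefix lacks `a + d`; the context supplies `a`, and `d` is left to the outer scopes. -/
theorem Drift.lstep {C C' : Ctx} {a d : Multiset Name} (h : Drift C a d C') {X Y : Proc}
    {κ : Label} (hX : LStep X κ (a + d) Y) :
    LStep (C.fill X) κ d ((C'.rename κ.sh).fill Y) := by
  induction h with
  | done d => rwa [zero_add] at hX
  | @rem C C' a d c _ ih => exact .use (ih (by simpa using hX))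
  | skip _ hc ih => exact (ih hX).keep hc
  | par _ ih => exact (ih hX).par_r _

/-- Above the point where the holes separate, only the sum `d + e` matters, so removal for either
partner is the same `use`. The hypothesis `hF` says that the communication operation acts inside the
contexts, cancelling the weakening of the receiver's context. -/
theorem Drift2.lstep {D D' : Ctx2} {a b d e : Multiset Name} (h : Drift2 D a b d e D')
    {X X' Y Y' U V : Proc} {κ₁ κ₂ : Label} {F : Proc → Proc → Proc}
    (hX : LStep X κ₁ (a + d) X') (hY : LStep Y κ₂ (b + e) Y') (hs : Sync κ₁ κ₂ F)
    (hF : ∀ C₁ C₂ : Ctx, F ((C₁.rename κ₁.sh).fill X') ((C₂.rename κ₂.sh).fill Y') =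
      Proc.par (C₁.fill U) (C₂.fill V)) :
    LStep (D.fill X Y) .tau (d + e) (D'.fill U V) := by
  induction h with
  | @spl C₁ C₂ C₁' C₂' _ _ _ _ h₁ h₂ =>
    have := (h₁.lstep hX).sync (h₂.lstep hY) hs
    rwa [hF] at this
  | @rem_l C C' a b d e c _ ih =>
    have := ih (by simpa using hX) hY
    rw [Multiset.cons_add] at this
    exact this.use
  | @rem_r C C' a b d e c _ ih =>
    have := ih hX (by simpa using hY)
    rw [Multiset.add_cons] at this
    exact this.use
  | skip _ hd he ih =>
    exact (ih hX hY).keep (by simp [hd, he])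
  | @par C C' a b d e R _ ih =>
    have := (ih hX hY).par_r R
    simp only [Label.sh, rename_id] at this
    exact this

theorem Red.lstep {P Q : Proc} (h : Red P Q) : ∃ Q', LStep P .tau 0 Q' ∧ NSC Q' Q := by
  induction h with
  | @comm D D' a b x P Q h =>
    have hF : ∀ C₁ C₂ : Ctx, (fun P Q => par P (Q.inst b))
        ((C₁.rename (Label.out a b).sh).fill (auth a P))
        ((C₂.rename (Label.inp a).sh).fill (auth (a + 1) (close x Q))) =
        par (C₁.fill (auth a P)) (C₂.fill (auth a (Q.subst b x))) := by
      intro C₁ C₂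
      simp only [Label.sh, Ctx.rename_id, inst, Ctx.fill_rename, Ctx.rename_rename]
      rw [subst_eq]
      exact congrArg (fun C => par _ (Ctx.fill C _)) C₂.rename_id
    exact ⟨_, h.lstep (.out a b P) (.inp a (close x Q)) (.out_inp a b) hF, .refl _⟩
  | @deleg D D' a b P Q h =>
    refine ⟨_, h.lstep (.sauth a b P) (.rauth a b Q) (.sauth_rauth a b) ?_, .refl _⟩
    intro C₁ C₂
    simp only [Label.sh, Ctx.rename_id]
  | stru h₁ _ h₂ ih =>
    obtain ⟨X, hX, e⟩ := ih
    -- The step of the congruent process is carried back to the original one.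
    obtain ⟨Y, hY, e'⟩ := h₁.nsc.sim.2 hX
    exact ⟨Y, hY, e'.symm.trans (e.trans h₂.nsc)⟩
  | newc a _ ih =>
    obtain ⟨X, hX, e⟩ := ih
    refine ⟨_, LStep.nu (hX.rename (closeMap_injective a)), .nu_congr ?_⟩
    simp only [Label.sw, Label.lift, rename_id]
    exact e.rename _

/-! ### Steps are reductions -/

/-- `Fire X κ x L Y`: the prefixed process `X` makes a step to `Y`, where `x` is the name that is
received in an input. -/
inductive Fire : Proc → Label → Name → Multiset Name → Proc → Prop
  | out (a b x : Name) (P : Proc) : Fire (out a b P) (.out a b) x {a} (auth a P)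
  | inp (a x : Name) (P : Proc) : Fire (inp a P) (.inp a) x {a} (auth a (P.inst x))
  | sauth (a b x : Name) (P : Proc) : Fire (sauth a b P) (.sauth a b) x {a, b} (auth a P)
  | rauth (a b x : Name) (P : Proc) : Fire (rauth a b P) (.rauth a b) x {a} (auth a (auth b P))

theorem Fire.rename {X Y : Proc} {κ : Label} {x : Name} {L : Multiset Name} (h : Fire X κ x L Y)
    (f : Name → Name) : Fire (X.rename f) (κ.map f) (f x) (L.map f) (Y.rename f) := by
  cases h
  · exact .out _ _ _ _
  · rename_i a P
    have e : ((P.rename (lift f)).inst (f x)) = (P.inst x).rename f := (inst_rename P x f).symm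
    have := Fire.inp (f a) (f x) (P.rename (lift f))
    rwa [e] at this
  · exact .sauth _ _ _ _
  · exact .rauth _ _ _ _

/-- Early steps of a process in a normal form: up to structural congruence, a prefix in a static
context below restrictions. -/
inductive NormStep : Proc → Label → Name → Multiset Name → Proc → Prop
  | base {C C' : Ctx} {X Y : Proc} {κ : Label} {x : Name} {a d : Multiset Name} :
      Fire X κ x (a + d) Y → Drift C a d C' → NormStep (C.fill X) κ x d (C'.fill Y)
  | stru {P P' Q Q' : Proc} {κ : Label} {x : Name} {L : Multiset Name} :
      NSC P P' → NormStep P' κ x L Q' → NSC Q' Q → NormStep P κ x L Q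
  | newc {P Q : Proc} {κ : Label} {x : Name} {L : Multiset Name} :
      NormStep P (κ.map Nat.succ) (x + 1) (L.map Nat.succ) Q → NormStep (nu P) κ x L (nu Q)

/-- The labels and the received name match without a name extrusion. -/
inductive Match : Label → Label → Name → Prop
  | comm (a x : Name) : Match (.out a x) (.inp a) x
  | deleg (a b x : Name) : Match (.sauth a b) (.rauth a b) x

theorem Match.map {κ₁ κ₂ : Label} {x : Name} (h : Match κ₁ κ₂ x) (f : Name → Name) :
    Match (κ₁.map f) (κ₂.map f) (f x) := by
  cases h
  · exact .comm _ _
  · exact .deleg _ _ _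

/-- Reductions that lack authorizations, with nameless restrictions. -/
inductive NormRed : Proc → Multiset Name → Proc → Prop
  | base {D D' : Ctx2} {X X' Y Y' : Proc} {κ₁ κ₂ : Label} {x : Name} {a b d e : Multiset Name} :
      Fire X κ₁ x (a + d) X' → Fire Y κ₂ x (b + e) Y' → Match κ₁ κ₂ x → Drift2 D a b d e D' →
      NormRed (D.fill X Y) (d + e) (D'.fill X' Y')
  | stru {P P' Q Q' : Proc} {L : Multiset Name} :
      NSC P P' → NormRed P' L Q' → NSC Q' Q → NormRed P L Q
  | newc {P Q : Proc} {L : Multiset Name} :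
      NormRed P (L.map Nat.succ) Q → NormRed (nu P) L (nu Q)

/-! ### Closure of normal forms under static contexts and communication -/

namespace NormStep

variable {P Q P' Q' : Proc} {κ κ₁ κ₂ : Label} {x : Name} {L L₁ L₂ : Multiset Name}

theorem rename (h : NormStep P κ x L Q) {f : Name → Name} (hf : f.Injective) :
    NormStep (P.rename f) (κ.map f) (f x) (L.map f) (Q.rename f) := by
  induction h generalizing f with
  | base hX h =>
    rw [Ctx.fill_rename, Ctx.fill_rename]
    have hX := hX.rename f
    rw [Multiset.map_add] at hX
    exact .base hX (h.rename (S := Set.univ) hf.injOn (Set.subset_univ _) (by simp))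
  | stru e₁ _ e₂ ih => exact .stru (e₁.rename f) (ih hf) (e₂.rename f)
  | newc _ ih =>
    refine .newc ?_
    have := ih (lift_injective hf)
    rwa [Label.map_succ_lift, Multiset.map_map, lift_comp_succ, ← Multiset.map_map] at this

theorem par (h : NormStep P κ x L Q) (R : Proc) : NormStep (par R P) κ x L (par R Q) := by
  induction h generalizing R with
  | base hX h => exact .base hX h.par
  | stru e₁ _ e₂ ih => exact .stru (.par_congr (.refl _) e₁) (ih R) (.par_congr (.refl _) e₂)
  | newc _ ih => exact .stru (.nu_extr _ _) (ih R.up).newc (NSC.nu_extr _ _).symm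

theorem use {c : Name} (h : NormStep P κ x (c ::ₘ L) Q) : NormStep (auth c P) κ x L Q := by
  generalize e : c ::ₘ L = M at h
  induction h generalizing c L with
  | base hX h =>
    subst e
    refine NormStep.base (C := .auth c _) ?_ h.rem
    simpa using hX
  | stru e₁ _ e₂ ih => exact .stru (.auth_congr _ e₁) (ih e) e₂
  | newc _ ih =>
    exact .stru (.scope_auth _ _) (ih (by rw [← e, Multiset.map_cons])).newc (.refl _)

theorem keep {c : Name} (h : NormStep P κ x L Q) (hc : c ∉ L) :
    NormStep (auth c P) κ x L (auth c Q) := by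
  induction h generalizing c with
  | base hX h => exact .base hX (h.skip hc)
  | stru e₁ _ e₂ ih => exact .stru (.auth_congr _ e₁) (ih hc) (.auth_congr _ e₂)
  | newc _ ih =>
    exact .stru (.scope_auth _ _) (ih (by simpa using hc)).newc (NSC.scope_auth _ _).symm

/-- The restrictions of the second partner are pulled out one at a time, weakening the first partner
each time. `sync` then does the same for the first partner, until both prefixes sit in one two-hole
context. -/
theorem sync_base {C C' : Ctx} {X Y : Proc} {a : Multiset Name} (hX : Fire X κ₁ x (a + L₁) Y)
    (hC : Drift C a L₁ C') (h : NormStep Q κ₂ x L₂ Q') (hm : Match κ₁ κ₂ x) :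
    NormRed (.par (C.fill X) Q) (L₁ + L₂) (.par (C'.fill Y) Q') := by
  induction h generalizing C C' X Y a κ₁ L₁ with
  | base hY h => exact NormRed.base (D := .split _ _) hX hY hm (.spl hC h)
  | stru e₁ _ e₂ ih =>
    exact .stru (.par_congr (.refl _) e₁) (ih hX hC hm) (.par_congr (.refl _) e₂)
  | newc _ ih =>
    have hX := hX.rename Nat.succ
    rw [Multiset.map_add] at hX
    have hC := hC.rename (f := Nat.succ) (S := Set.univ) Nat.succ_injective.injOn
      (Set.subset_univ _) (by simp)
    have := ih hX hC (hm.map _)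
    rw [← Ctx.fill_rename, ← Ctx.fill_rename, ← Multiset.map_add] at this
    exact .stru (.nu_extr _ _) this.newc (NSC.nu_extr _ _).symm

theorem sync (h₁ : NormStep P κ₁ x L₁ P') (h₂ : NormStep Q κ₂ x L₂ Q') (hm : Match κ₁ κ₂ x) :
    NormRed (.par P Q) (L₁ + L₂) (.par P' Q') := by
  induction h₁ generalizing Q Q' κ₂ L₂ with
  | base hX h => exact h₂.sync_base hX h hm
  | stru e₁ _ e₂ ih =>
    exact .stru (.par_congr e₁ (.refl _)) (ih h₂ hm) (.par_congr e₂ (.refl _))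
  | newc _ ih =>
    have := ih (h₂.rename Nat.succ_injective) (hm.map _)
    rw [← Multiset.map_add] at this
    exact .stru (.extr_nu _ _) this.newc (NSC.extr_nu _ _).symm

end NormStep

namespace NormRed

variable {P Q : Proc} {L : Multiset Name}

theorem par (h : NormRed P L Q) (R : Proc) : NormRed (par R P) L (par R Q) := by
  induction h generalizing R with
  | base hX hY hm h => exact .base hX hY hm h.par
  | stru e₁ _ e₂ ih => exact .stru (.par_congr (.refl _) e₁) (ih R) (.par_congr (.refl _) e₂)
  | newc _ ih => exact .stru (.nu_extr _ _) (ih R.up).newc (NSC.nu_extr _ _).symm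

theorem use {c : Name} (h : NormRed P (c ::ₘ L) Q) : NormRed (auth c P) L Q := by
  generalize e : c ::ₘ L = M at h
  induction h generalizing c L with
  | @base D D' X X' Y Y' κ₁ κ₂ x a b d₁ d₂ hX hY hm h =>
    have hc : c ∈ d₁ + d₂ := by rw [← e]; simp
    -- The scope is assigned to a partner that lacks `c`; drift allows either choice.
    rcases Multiset.mem_add.1 hc with hc | hc
    · obtain ⟨d, rfl⟩ := Multiset.exists_cons_of_mem hc
      rw [Multiset.cons_add, Multiset.cons_inj_right] at e
      subst e
      exact NormRed.base (D := .auth c D) (by simpa using hX) hY hm h.rem_l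
    · obtain ⟨d, rfl⟩ := Multiset.exists_cons_of_mem hc
      rw [Multiset.add_cons, Multiset.cons_inj_right] at e
      subst e
      exact NormRed.base (D := .auth c D) hX (by simpa using hY) hm h.rem_r
  | stru e₁ _ e₂ ih => exact .stru (.auth_congr _ e₁) (ih e) e₂
  | newc _ ih =>
    exact .stru (.scope_auth _ _) (ih (by rw [← e, Multiset.map_cons])).newc (.refl _)

theorem keep {c : Name} (h : NormRed P L Q) (hc : c ∉ L) : NormRed (auth c P) L (auth c Q) := by
  induction h generalizing c with
  | base hX hY hm h =>
    rw [Multiset.mem_add, not_or] at hc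
    exact .base hX hY hm (h.skip hc.1 hc.2)
  | stru e₁ _ e₂ ih => exact .stru (.auth_congr _ e₁) (ih hc) (.auth_congr _ e₂)
  | newc _ ih =>
    exact .stru (.scope_auth _ _) (ih (by simpa using hc)).newc (NSC.scope_auth _ _).symm

theorem comm {P' Q' : Proc} (h : NormRed (.par P Q) L (.par P' Q')) :
    NormRed (.par Q P) L (.par Q' P') :=
  .stru (.par_comm _ _) h (.par_comm _ _)

end NormRed

/-! ### Bringing late steps into normal form -/

namespace LStep

variable {P Q : Proc} {κ : Label} {L : Multiset Name}

/-- A step without bound names and communications can be brought into normal form. -/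
theorem normStep (h : LStep P κ L Q) (h₁ : κ ≠ .tau) (h₂ : ∀ a, κ ≠ .bout a) (x : Name) :
    NormStep P κ x L (Q.rename (κ.ins x)) := by
  have hole : ∀ {X Y : Proc} {κ : Label} {x : Name} {L : Multiset Name}, Fire X κ x L Y →
      NormStep X κ x L Y := fun {X Y κ x L} h =>
    NormStep.base (C := .hole) (C' := .hole) (a := 0) (by simpa using h) (.done _)
  have cancel : ∀ (κ : Label) (R : Proc) (x : Name), (R.rename κ.sh).rename (κ.ins x) = R := by
    intro κ R x
    rw [rename_rename, Label.ins_comp_sh, rename_id]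
  induction h generalizing x with
  | out a b P => simp only [Label.ins, rename_id]; exact hole (.out _ _ _ _)
  | inp a P => exact hole (.inp _ _ _)
  | sauth a b P => simp only [Label.ins, rename_id]; exact hole (.sauth _ _ _ _)
  | rauth a b P => simp only [Label.ins, rename_id]; exact hole (.rauth _ _ _ _)
  | rep a P =>
    -- One unfolded copy fires. It lacks only `a`, which its own scope supplies, so nothing is
    -- lacking outside.
    refine .stru (.rep_unfold a P) ((hole (.inp a x P)).use (L := 0) |>.par (Proc.rep a P)) ?_
    refine (NSC.par_comm _ _).trans (.of_eq ?_)
    exact congrArg (Proc.par _) (inst_up _ _).symm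
  | par_l R _ ih =>
    refine .stru (.par_comm _ _) ((ih h₁ h₂ x).par R) ((NSC.par_comm _ _).trans (.of_eq ?_))
    simp only [Proc.rename, cancel]
  | par_r R _ ih =>
    refine .stru (.refl _) ((ih h₁ h₂ x).par R) (.of_eq ?_)
    simp only [Proc.rename, cancel]
  | @nu P Q κ L _ ih =>
    have := ih (by cases κ <;> simp_all [Label.map]) (by cases κ <;> simp_all [Label.map]) (x + 1)
    refine .stru (.refl _) this.newc (.of_eq (congrArg Proc.nu ?_))
    rw [Label.ins_map, rename_rename]
    exact rename_ext fun n => by cases κ <;> rcases n with _ | _ | n <;> rfl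
  | opn => exact absurd rfl (h₂ _)
  | use _ ih => exact (ih h₁ h₂ x).use
  | @keep P Q κ L c _ hc ih =>
    refine .stru (.refl _) ((ih h₁ h₂ x).keep hc) (.of_eq ?_)
    exact congrArg (Proc.auth · _) (congrFun (κ.ins_comp_sh x) c).symm
  | sync => exact absurd rfl h₁

/-- A bound output is, up to structural congruence, a free output below a restriction. -/
theorem bout_inv {a : Name} (h : LStep P (.bout a) L Q) :
    ∃ P₁ Q₁, NSC P (Proc.nu P₁) ∧ LStep P₁ (.out (a + 1) 0) (L.map Nat.succ) Q₁ ∧ NSC Q₁ Q := by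
  generalize e : Label.bout a = κ at h
  induction h generalizing a with
  | @par_l P P' κ L R _ ih =>
    obtain ⟨P₁, Q₁, e₁, h, e₂⟩ := ih e
    subst e
    refine ⟨_, _, (NSC.par_congr e₁ (.refl R)).trans (.extr_nu _ _), h.par_l R.up,
      .par_congr e₂ (.of_eq (rename_id _))⟩
  | @par_r P P' κ L R _ ih =>
    obtain ⟨P₁, Q₁, e₁, h, e₂⟩ := ih e
    subst e
    exact ⟨_, _, (NSC.par_congr (.refl R) e₁).trans (.nu_extr _ _), h.par_r R.up,
      .par_congr (.of_eq (rename_id _)) e₂⟩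
  | @nu P P' κ L _ ih =>
    subst e
    obtain ⟨P₁, Q₁, e₁, h, e₂⟩ := ih rfl
    -- The extruding restriction is found below the present one; exchanging the two brings it to the
    -- outside.
    have h' := h.rename swp_injective
    rw [Multiset.map_map, Multiset.map_map,
      show (swp ∘ Nat.succ) ∘ Nat.succ = Nat.succ ∘ Nat.succ from rfl, ← Multiset.map_map] at h'
    refine ⟨_, _, (NSC.nu_congr e₁).trans (.nu_swap _), LStep.nu (κ := .out (a + 1) 0) h',
      .nu_congr ?_⟩
    simp only [Label.sw, Label.lift, rename_id]
    exact e₂.rename _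
  | opn h =>
    cases e
    exact ⟨_, _, .refl _, h, .refl _⟩
  | @use P P' κ L c _ ih =>
    obtain ⟨P₁, Q₁, e₁, h, e₂⟩ := ih e
    rw [Multiset.map_cons] at h
    exact ⟨_, _, (NSC.auth_congr c e₁).trans (.scope_auth _ _), h.use, e₂⟩
  | @keep P P' κ L c _ hc ih =>
    obtain ⟨P₁, Q₁, e₁, h, e₂⟩ := ih e
    subst e
    exact ⟨_, _, (NSC.auth_congr c e₁).trans (.scope_auth _ _),
      h.keep (c := c + 1) (by simpa using hc), .auth_congr _ e₂⟩
  | _ => cases e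

/-- Once the extruding restriction is outermost, its scope is extended over the weakened receiver,
and the exchange becomes a free communication of the name `0` below it. -/
theorem sync_bout {P' Q' : Proc} {a : Name} {L₁ L₂ : Multiset Name} (h₁ : LStep P (.bout a) L₁ P')
    (h₂ : LStep Q (.inp a) L₂ Q') :
    NormRed (Proc.par P Q) (L₁ + L₂) (Proc.nu (Proc.par P' Q')) := by
  obtain ⟨P₁, Q₁, e₁, h, e₂⟩ := h₁.bout_inv
  have s₁ := h.normStep (by simp) (by simp) 0
  have s₂ := (h₂.rename Nat.succ_injective).normStep (by simp [Label.map]) (by simp [Label.map]) 0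
  have s := s₁.sync s₂ (.comm _ _)
  rw [← Multiset.map_add] at s
  refine .stru ((NSC.par_congr e₁ (.refl _)).trans (.extr_nu _ _)) s.newc
    (.nu_congr (.par_congr ((NSC.of_eq (rename_id _)).trans e₂) (.of_eq ?_)))
  exact rename_lift_succ_inst Q'

theorem normRed (h : LStep P .tau L Q) : NormRed P L Q := by
  generalize e : Label.tau = κ at h
  induction h with
  | @par_l P P' κ L R _ ih =>
    subst e
    simp only [Label.sh, rename_id]
    exact ((ih rfl).par R).comm
  | @par_r P P' κ L R _ ih =>
    subst e
    simp only [Label.sh, rename_id]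
    exact (ih rfl).par R
  | @nu P P' κ L _ ih =>
    subst e
    simp only [Label.sw, rename_id]
    exact (ih rfl).newc
  | use _ ih => exact (ih e).use
  | keep _ hc ih =>
    subst e
    exact (ih rfl).keep hc
  | sync h₁ h₂ hs =>
    cases hs with
    | out_inp a b =>
      have := (h₁.normStep (by simp) (by simp) b).sync (h₂.normStep (by simp) (by simp) b)
        (.comm _ _)
      simp only [Label.ins, rename_id] at this
      exact this
    | inp_out a b =>
      have := (h₂.normStep (by simp) (by simp) b).sync (h₁.normStep (by simp) (by simp) b)
        (.comm _ _)
      rw [add_comm]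
      simp only [Label.ins, rename_id] at this
      exact this.comm
    | sauth_rauth a b =>
      have := (h₁.normStep (by simp) (by simp) 0).sync (h₂.normStep (by simp) (by simp) 0)
        (.deleg _ _ _)
      simpa only [Label.ins, rename_id] using this
    | rauth_sauth a b =>
      have := (h₂.normStep (by simp) (by simp) 0).sync (h₁.normStep (by simp) (by simp) 0)
        (.deleg _ _ _)
      rw [add_comm]
      simp only [Label.ins, rename_id] at this
      exact this.comm
    | bout_inp a => exact h₁.sync_bout h₂
    | inp_bout a =>
      have := h₂.sync_bout h₁
      rw [add_comm]
      exact .stru (.par_comm _ _) this (.nu_congr (.par_comm _ _))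
  | _ => cases e

end LStep

/-! ### Return to named binders -/

theorem Red.comm_nameless {D D' : Ctx2} (a b : Name) (P Q : Proc) (h : Drift2 D {a} {a} 0 0 D') :
    Red (D.fill (Proc.out a b P) (Proc.inp a Q)) (D'.fill (auth a P) (auth a (Q.inst b))) := by
  obtain ⟨y, hy⟩ := exists_fresh (finite_pred Q.finite_fn) id
  have e : close y (Q.inst y) = Q := close_inst Q y fun h => hy y h rfl
  have := Red.comm a b y P (Q.inst y) h
  rwa [subst_eq, input, e] at this

/-- The base case needs injectivity on the names of the context only, and structural congruence
survives every renaming. Below a restriction, `ncons a f` with `a` fresh is injective on `S` as soon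
as `f` is injective on the names that `S` has outside the binder. -/
theorem NormRed.exists_finite {P Q : Proc} {L : Multiset Name} (h : NormRed P L Q) (hL : L = 0) :
    ∃ S : Set Name, S.Finite ∧ ∀ f : Name → Name, Set.InjOn f S → Red (P.rename f) (Q.rename f) := by
  induction h with
  | @base D D' X X' Y Y' κ₁ κ₂ x a b d e hX hY hm h =>
    obtain ⟨rfl, rfl⟩ : d = 0 ∧ e = 0 := by simpa using hL
    refine ⟨_, (D.fill nil nil).finite_fn, fun f hf => ?_⟩
    have h' := h.rename hf subset_rfl (by simp) (by simp)
    have hX' := hX.rename f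
    have hY' := hY.rename f
    have hm' := hm.map f
    simp only [Multiset.map_zero, add_zero] at h' hX' hY'
    rw [Ctx2.fill_rename, Ctx2.fill_rename]
    -- The renamed data are abstracted, so that case analysis on the matching labels need not invert
    -- `f`.
    generalize X.rename f = X at hX' ⊢
    generalize Y.rename f = Y at hY' ⊢
    generalize X'.rename f = X' at hX' ⊢
    generalize Y'.rename f = Y' at hY' ⊢
    generalize κ₁.map f = κ₁ at hX' hm'
    generalize κ₂.map f = κ₂ at hY' hm'
    generalize a.map f = a at hX' h'
    generalize b.map f = b at hY' h'
    generalize f x = x at hX' hY' hm'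
    cases hm' with
    | comm c =>
      cases hX'
      cases hY'
      exact Red.comm_nameless _ _ _ _ h'
    | deleg =>
      cases hX'
      cases hY'
      exact Red.deleg _ _ _ _ h'
  | stru e₁ _ e₂ ih =>
    obtain ⟨S, hS, h⟩ := ih hL
    exact ⟨S, hS, fun f hf => .stru (e₁.sc_rename f) (h f hf) (e₂.sc_rename f)⟩
  | @newc P Q L _ ih =>
    obtain ⟨S, hS, h⟩ := ih (by simp [hL])
    refine ⟨{n | n + 1 ∈ S}, finite_pred hS, fun f hf => ?_⟩
    obtain ⟨a, ha⟩ := exists_fresh ((finite_pred hS).union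
      ((finite_pred P.finite_fn).union (finite_pred Q.finite_fn))) f
    simp only [Proc.rename]
    rw [nu_rename_eq_res P f a fun n hn => ha n (Or.inr (Or.inl hn)),
      nu_rename_eq_res Q f a fun n hn => ha n (Or.inr (Or.inr hn))]
    refine .newc a (h _ ?_)
    rintro (_ | m) hm (_ | n) hn e
    · rfl
    · exact absurd e.symm (ha n (Or.inl hn))
    · exact absurd e (ha m (Or.inl hm))
    · exact congrArg _ (hf hm hn e)

theorem NormRed.red {P Q : Proc} (h : NormRed P 0 Q) : Red P Q := by
  obtain ⟨S, -, h⟩ := h.exists_finite rfl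
  simpa only [rename_id] using h id fun _ _ _ _ e => e

end FloatAuth

theorem theorem1 (P Q : FloatAuth.Proc) :
    FloatAuth.Red P Q ↔ ∃ Q' : FloatAuth.Proc, FloatAuth.TauStep P Q' ∧ FloatAuth.SC Q' Q := by
  constructor
  · intro h
    obtain ⟨Q', h', e⟩ := h.lstep
    exact ⟨Q', h'.step_tau, e.sc⟩
  · rintro ⟨Q', h, e⟩
    exact .stru (.refl _) (FloatAuth.Step.lstep_tau h).normRed.red e
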